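/- Let $b\ge 1$ be an integer and $r=\frac{b}{2b+1}$. The bubble-diamond graphs $G_\ell=(V_\ell,E_\ell)$ are defined as follows: $G_0$ consists of two vertices $q_1,q_2$ joined by an edge, and $G_{\ell+1}$ is obtained from $G_\ell$ by replacing every edge $\{x,y\}$ by two new vertices $x',y'$, one edge $\{x,x'\}$, one edge $\{y,y'\}$ and $b$ parallel edges $\{x',y'\}$. Let $p_1,p_2$ be the two new vertices of $G_1$, adjacent to $q_1,q_2$ respectively. Let $F_1,\dots,F_{b+2}$ be the maps of $V_*=\bigcup_\ell V_\ell$ into itself onto the $b+2$ glued copies of $V_*$, with $F_i(q_1)=p_1$, $F_i(q_2)=p_2$ for $i\le b$; $F_{b+1}(q_1)=q_1$, $F_{b+1}(q_2)=p_1$; $F_{b+2}(q_1)=p_2$, $F_{b+2}(q_2)=q_2$. For $f:V_*\to\mathbb R$ let $\mathcal E(f)=\lim_{\ell\to\infty} r^{-\ell}\sum_{\{x,y\}\in E_\ell}|f(x)-f(y)|^2\in[0,\infty]$ (parallel edges counted with multiplicity), and let $\mathcal E(f,g)=\frac14(\mathcal E(f+g)-\mathcal E(f-g))$ for $f,g$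 of finite energy. Let $R(x,y)$ be the least $R$ such that $|f(x)-f(y)|^2\le R\,\mathcal E(f)$ for all $f$ of finite energy, and let the bubble-diamond fractal $K_b$ be the completion of $V_*$ in the metric $R$; the maps $F_i$ extend continuously to $K_b$. Let $\operatorname{dom}\mathcal E$ be the set of continuous functions on $K_b$ whose restriction to $V_*$ has finite energy. Let $\mu$ be the self-similar measure, that is, the Borel measure on $K_b$ with $\mu(K_b)=1$ and $\mu(A)=\frac1{b+2}\sum_{i=1}^{b+2}\mu(F_i^{-1}A)$ for all Borel sets $A$. For $u\in\operatorname{dom}\mathcal E$ and $v$ continuous on $K_b$, write $\Delta u=v$ if $\mathcal E(u,g)=-\int_{K_b} v g\,d\mu$ for all $g\in\operatorname{dom}\mathcal E$ with $g(q_1)=g(q_2)=0$. For $j\ge0$ and $k\in\{1,2\}$ let $f_{jk}$ be the solution of $\Delta^{j+1}f_{jk}=0$ with $\Delta^m f_{jk}(q_n)=\delta_{jm}\delta_{kn}$ for $0\le m\le j$, $n\in\{1,2\}$. **Theorem.** The measure $\mu$ and the functions $f_{jk}$ exist and are unique. For $\ell\ge0$ and $\{k,n\}=\{1,2\}$ put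 $$a_\ell=\int_{K_b} f_{\ell k}f_{0k}\,d\mu,\qquad b_\ell=\int_{K_b} f_{\ell k}f_{0n}\,d\mu,$$ $$p_\ell=\Big(\frac{r}{b+2}\Big)^{-\ell}f_{\ell k}(F_iq_k),\qquad q_\ell=\Big(\frac{r}{b+2}\Big)^{-\ell}f_{\ell k}(F_iq_n)\qquad(1\le i\le b).$$ These quantities do not depend on the choice of $k$ and $i$, and one also has $p_\ell=\big(\frac{r}{b+2}\big)^{-\ell}f_{\ell k}(F_{b+k}q_n)$ and $q_\ell=\big(\frac{r}{b+2}\big)^{-\ell}f_{\ell k}(F_{b+n}q_k)$. Their initial values are $$a_0=\frac{b+1}{2+4b},\qquad b_0=\frac{b}{2+4b},\qquad p_0=\frac{b+1}{2b+1},\qquad q_0=\frac{b}{2b+1},$$ and for every $j>0$ $$(2b+1)p_j=-\sum_{\ell=0}^{j-1}\Big[p_{j-\ell-1}\big((b+1)^2a_\ell+b^2b_\ell\big)+b(b+1)\,q_{j-\ell-1}(a_\ell+b_\ell)\Big]-(b+1)\,b_{j-1},$$ $$(2b+1)q_j=-\sum_{\ell=0}^{j-1}\Big[b(b+1)\,p_{j-\ell-1}(a_\ell+b_\ell)+q_{j-\ell-1}\big((b+1)^2a_\ell+b^2b_\ell\big)\Big]-b\,b_{j-1}.$$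 -/

import Mathlib

open MeasureTheory
open scoped ENNReal

namespace BubbleDiamond

/-- The vertex set `V_* = ⋃ V_ℓ` of the bubble-diamond graphs with branching parameter `b`.

`bdry 0`, `bdry 1` are the two vertices `q₁`, `q₂` of `G_0`.  The edges of `G_ℓ` are indexed by
the words `w` of length `ℓ` in `b + 2` letters, and `inner w 0`, `inner w 1` are the two new
vertices that are introduced when the edge `w` of `G_ℓ` is modified to get `G_{ℓ+1}`; `inner w k`
is the one that is joined to the `k`-th endpoint of that edge.  Thus `V_ℓ` consists of `bdry k` and
of the `inner w k` with `w` of length less than `ℓ`. -/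
inductive Vert (b : ℕ) : Type
  | bdry (k : Fin 2) : Vert b
  | inner (w : List (Fin (b + 2))) (k : Fin 2) : Vert b

variable {b : ℕ}

/-- The map `F_i : V_* → V_*` onto the `i`-th of the `b + 2` glued copies.  The letters
`0, …, b - 1` stand for the `b` parallel copies between the two new vertices of `G_1`
(with `q₁`, `q₂` sent to `inner [] 0`, `inner [] 1`), the letter `b` for the copy between
`q₁` and `inner [] 0`, and the letter `b + 1` for the copy between `inner [] 1` and `q₂`. -/
def F (i : Fin (b + 2)) : Vert b → Vert b
  | .inner w k => .inner (i :: w) k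
  | .bdry k =>
      if (i : ℕ) < b then .inner [] k
      else if (i : ℕ) = b then (if k = 0 then .bdry 0 else .inner [] 0)
      else (if k = 0 then .inner [] 1 else .bdry 1)

/-- `F_w = F_{w_1} ∘ ⋯ ∘ F_{w_m}`. The edge `w` of `G_m` joins `F_w q₁` and `F_w q₂`. -/
def Fword (w : List (Fin (b + 2))) (x : Vert b) : Vert b := w.foldr F x

/-- The renormalization constant `r = b / (2b + 1)`. -/
noncomputable def renorm (b : ℕ) : ℝ := (b : ℝ) / (2 * b + 1)

/-- The energy `r^{-ℓ} ∑ (f x - f y)²` of `f` on `G_ℓ`, the sum running over all the edges of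
`G_ℓ`, each of the `b` parallel edges being counted. -/
noncomputable def levelEnergy (ℓ : ℕ) (f : Vert b → ℝ) : ℝ :=
  (renorm b ^ ℓ)⁻¹ * ∑ w : Fin ℓ → Fin (b + 2),
    (f (Fword (List.ofFn w) (.bdry 0)) - f (Fword (List.ofFn w) (.bdry 1))) ^ 2

/-- The graph energy `ℰ(f) = lim ℰ_ℓ(f) ∈ [0, ∞]` of a function on `V_*`, the limit of a
nondecreasing sequence (see `levelEnergy_mono` and `tendsto_levelEnergy`). -/
noncomputable def energy (f : Vert b → ℝ) : ℝ≥0∞ :=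
  ⨆ ℓ : ℕ, ENNReal.ofReal (levelEnergy ℓ f)

/-- The bilinear form `ℰ(f, g) = (ℰ(f + g) - ℰ(f - g)) / 4`. It is used for `f` and `g` of finite
energy only. -/
noncomputable def energyForm (f g : Vert b → ℝ) : ℝ :=
  ((energy (f + g)).toReal - (energy (f - g)).toReal) / 4

/-- The resistance `R(x, y)`: the least `R` with `|f x - f y|² ≤ R ℰ(f)` for all `f` of finite
energy. -/
noncomputable def resistance (x y : Vert b) : ℝ≥0∞ :=
  sInf {R : ℝ≥0∞ | ∀ f : Vert b → ℝ, energy f < ∞ →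
    ENNReal.ofReal ((f x - f y) ^ 2) ≤ R * energy f}

/-! ### Monotonicity of the energies -/

lemma levelEnergy_nonneg (ℓ : ℕ) (f : Vert b → ℝ) : 0 ≤ levelEnergy ℓ f := by
  unfold levelEnergy renorm
  positivity

lemma levelEnergy_zero (f : Vert b → ℝ) :
    levelEnergy 0 f = (f (.bdry 0) - f (.bdry 1)) ^ 2 := by
  simp [levelEnergy, Fword]

lemma levelEnergy_succ (ℓ : ℕ) (f : Vert b → ℝ) :
    levelEnergy (ℓ + 1) f = (renorm b)⁻¹ * ∑ i : Fin (b + 2), levelEnergy ℓ (f ∘ F i) := by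
  unfold levelEnergy
  rw [← Finset.mul_sum, ← mul_assoc, ← mul_inv, ← pow_succ']
  congr 1
  rw [← (Fin.consEquiv fun _ : Fin (ℓ + 1) => Fin (b + 2)).sum_comp, Fintype.sum_prod_type]
  simp [Fin.consEquiv, Fword]

lemma sum_letters (g : Fin (b + 2) → ℝ) :
    ∑ i, g i = (∑ i : Fin b, g i.castSucc.castSucc) + g (Fin.last b).castSucc
      + g (Fin.last (b + 1)) := by
  rw [Fin.sum_univ_castSucc, Fin.sum_univ_castSucc]

lemma levelEnergy_le_succ (hb : 1 ≤ b) (ℓ : ℕ) (f : Vert b → ℝ) :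
    levelEnergy ℓ f ≤ levelEnergy (ℓ + 1) f := by
  have hb' : (0 : ℝ) < b := by exact_mod_cast hb
  have hr : 0 < renorm b := by unfold renorm; positivity
  induction ℓ generalizing f with
  | zero =>
    rw [levelEnergy_succ, levelEnergy_zero, sum_letters]
    simp only [levelEnergy_zero, Function.comp, F]
    simp
    set A := f (.bdry 0)
    set P := f (.inner [] 0)
    set Q := f (.inner [] 1)
    set D := f (.bdry 1)
    rw [inv_mul_eq_div, le_div_iff₀ hr, renorm, mul_div_assoc', div_le_iff₀ (by positivity)]
    nlinarith [sq_nonneg ((A - P) - b * (P - Q)), sq_nonneg ((Q - D) - b * (P - Q)),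
      mul_nonneg hb'.le (sq_nonneg ((A - P) - (Q - D)))]
  | succ ℓ ih =>
    rw [levelEnergy_succ ℓ, levelEnergy_succ (ℓ + 1)]
    gcongr with i
    exact ih _

lemma renorm_zero : renorm 0 = 0 := by simp [renorm]

lemma levelEnergy_mono (hb : 1 ≤ b) (f : Vert b → ℝ) : Monotone fun ℓ => levelEnergy ℓ f :=
  monotone_nat_of_le_succ fun ℓ => levelEnergy_le_succ hb ℓ f

lemma tendsto_levelEnergy (hb : 1 ≤ b) (f : Vert b → ℝ) :
    Filter.Tendsto (fun ℓ => ENNReal.ofReal (levelEnergy ℓ f)) Filter.atTop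
      (nhds (energy f)) :=
  tendsto_atTop_iSup fun _ _ h => ENNReal.ofReal_le_ofReal (levelEnergy_mono hb f h)

/-! ### The resistance is a pseudometric -/

lemma levelEnergy_split (ℓ : ℕ) (f : Vert b → ℝ) (c : ℝ) :
    levelEnergy ℓ (fun x => max (f x) c) + levelEnergy ℓ (fun x => min (f x) c)
      ≤ levelEnergy ℓ f := by
  unfold levelEnergy
  rw [← mul_add, ← Finset.sum_add_distrib]
  refine mul_le_mul_of_nonneg_left (Finset.sum_le_sum fun w _ => ?_)
    (by unfold renorm; positivity)
  dsimp only
  generalize f (Fword (List.ofFn w) (.bdry 0)) = s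
  generalize f (Fword (List.ofFn w) (.bdry 1)) = t
  rcases le_total s c with hs | hs <;> rcases le_total t c with ht | ht <;>
    simp only [max_eq_left, max_eq_right, min_eq_left, min_eq_right, hs, ht] <;> nlinarith

lemma energy_split (f : Vert b → ℝ) (c : ℝ) :
    energy (fun x => max (f x) c) + energy (fun x => min (f x) c) ≤ energy f := by
  rcases Nat.eq_zero_or_pos b with rfl | hb
  · have h0 : ∀ g : Vert 0 → ℝ, energy g = ENNReal.ofReal (levelEnergy 0 g) := by
      intro g
      refine le_antisymm (iSup_le fun ℓ => ?_) (le_iSup (fun ℓ => ENNReal.ofReal _) 0)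
      rcases ℓ with _ | ℓ
      · exact le_rfl
      · simp [levelEnergy, renorm_zero]
    rw [h0, h0, h0, ← ENNReal.ofReal_add (levelEnergy_nonneg _ _) (levelEnergy_nonneg _ _)]
    exact ENNReal.ofReal_le_ofReal (levelEnergy_split 0 f c)
  · refine le_of_tendsto_of_tendsto' ((tendsto_levelEnergy hb _).add (tendsto_levelEnergy hb _))
      (tendsto_levelEnergy hb f) fun ℓ => ?_
    rw [← ENNReal.ofReal_add (levelEnergy_nonneg _ _) (levelEnergy_nonneg _ _)]
    exact ENNReal.ofReal_le_ofReal (levelEnergy_split ℓ f c)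

lemma ofReal_sq_add_le {s t : ℝ} {A B x y : ℝ≥0∞} (hx : x < ∞) (hy : y < ∞)
    (h1 : ENNReal.ofReal (s ^ 2) ≤ A * x) (h2 : ENNReal.ofReal (t ^ 2) ≤ B * y) :
    ENNReal.ofReal ((s + t) ^ 2) ≤ (A + B) * (x + y) := by
  by_cases hxy : x + y = 0
  · obtain ⟨rfl, rfl⟩ := add_eq_zero.1 hxy
    simp only [mul_zero, nonpos_iff_eq_zero, ENNReal.ofReal_eq_zero] at h1 h2
    have hs : s = 0 := pow_eq_zero_iff (two_ne_zero) |>.1 (le_antisymm h1 (sq_nonneg s))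
    have ht : t = 0 := pow_eq_zero_iff (two_ne_zero) |>.1 (le_antisymm h2 (sq_nonneg t))
    simp [hs, ht]
  by_cases hA : A = ∞
  · simp [hA, ENNReal.top_mul hxy]
  by_cases hB : B = ∞
  · simp [hB, ENNReal.top_mul hxy]
  lift A to NNReal using hA
  lift B to NNReal using hB
  lift x to NNReal using hx.ne
  lift y to NNReal using hy.ne
  rw [← ENNReal.coe_mul, ← ENNReal.ofReal_coe_nnreal, NNReal.coe_mul,
    ENNReal.ofReal_le_ofReal_iff (by positivity)] at h1 h2
  rw [← ENNReal.coe_add, ← ENNReal.coe_add, ← ENNReal.coe_mul, ← ENNReal.ofReal_coe_nnreal]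
  refine ENNReal.ofReal_le_ofReal ?_
  push_cast
  have hA := A.coe_nonneg
  have hB := B.coe_nonneg
  have hx := x.coe_nonneg
  have hy := y.coe_nonneg
  generalize (A : ℝ) = A at *
  generalize (B : ℝ) = B at *
  generalize (x : ℝ) = x at *
  generalize (y : ℝ) = y at *
  have hst : 2 * (s * t) ≤ A * y + B * x := by
    refine (abs_le_of_sq_le_sq' ?_ (by positivity)).2
    have := mul_le_mul h1 h2 (sq_nonneg t) (by positivity)
    nlinarith [sq_nonneg (A * y - B * x)]
  nlinarith

lemma resistance_triangle (x y z : Vert b) :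
    resistance x z ≤ resistance x y + resistance y z := by
  unfold resistance
  rw [sInf_eq_iInf (s := {R : ℝ≥0∞ | ∀ f : Vert b → ℝ, energy f < ∞ →
      ENNReal.ofReal ((f x - f y) ^ 2) ≤ R * energy f}),
    sInf_eq_iInf (s := {R : ℝ≥0∞ | ∀ f : Vert b → ℝ, energy f < ∞ →
      ENNReal.ofReal ((f y - f z) ^ 2) ≤ R * energy f})]
  refine ENNReal.le_iInf₂_add_iInf₂ fun A hA B hB => sInf_le fun f hf => ?_
  have key : ∀ g : Vert b → ℝ, energy g < ∞ → g z ≤ g x →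
      ENNReal.ofReal ((g x - g z) ^ 2) ≤ (A + B) * energy g := by
    intro g hg hzx
    rcases lt_or_ge (g y) (g z) with h | h
    · calc ENNReal.ofReal ((g x - g z) ^ 2) ≤ ENNReal.ofReal ((g x - g y) ^ 2) :=
            ENNReal.ofReal_le_ofReal (by nlinarith)
        _ ≤ A * energy g := hA g hg
        _ ≤ (A + B) * energy g := by gcongr; exact le_self_add
    rcases lt_or_ge (g x) (g y) with h' | h'
    · calc ENNReal.ofReal ((g x - g z) ^ 2) ≤ ENNReal.ofReal ((g y - g z) ^ 2) :=
            ENNReal.ofReal_le_ofReal (by nlinarith)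
        _ ≤ B * energy g := hB g hg
        _ ≤ (A + B) * energy g := by gcongr; exact le_add_self
    have hs := energy_split g (g y)
    have h1 : energy (fun v => max (g v) (g y)) < ∞ :=
      lt_of_le_of_lt (le_self_add.trans hs) hg
    have h2 : energy (fun v => min (g v) (g y)) < ∞ :=
      lt_of_le_of_lt (le_add_self.trans hs) hg
    have hx := hA _ h1
    have hy := hB _ h2
    simp only [max_self, min_self, max_eq_left h', min_eq_left h] at hx hy
    have := ofReal_sq_add_le h1 h2 hx hy
    rw [sub_add_sub_cancel] at this
    exact this.trans (by gcongr)
  rcases le_total (f z) (f x) with h | h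
  · exact key f hf h
  · have hn : energy (fun v => -f v) = energy f := by
      unfold energy levelEnergy
      congr! 5 with ℓ w
      ring
    have := key (fun v => -f v) (hn ▸ hf) (by simpa using h)
    rw [hn] at this
    convert this using 2
    ring

/-- `V_*` with the resistance metric. -/
noncomputable instance : PseudoEMetricSpace (Vert b) where
  edist := resistance
  edist_self x := by
    refine le_antisymm (sInf_le fun f _ => by simp) bot_le
  edist_comm x y := by
    unfold resistance
    congr! 7 with R f
    ring
  edist_triangle := resistance_triangle

/-! ### The fractal, its measure and its Laplacian -/

/-- The bubble-diamond fractal `K_b`: the completion of `V_*` in the resistance metric. -/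
noncomputable abbrev K (b : ℕ) : Type := UniformSpace.Completion (Vert b)

noncomputable instance : MeasurableSpace (K b) := borel _

instance : BorelSpace (K b) := ⟨rfl⟩

/-- The boundary points `q₁`, `q₂` of `K_b`. -/
noncomputable def q (k : Fin 2) : K b := ((Vert.bdry k : Vert b) : K b)

lemma energy_comp_F_le (hb : 1 ≤ b) (i : Fin (b + 2)) (f : Vert b → ℝ) :
    energy (f ∘ F i) ≤ ENNReal.ofReal (renorm b) * energy f := by
  have hb' : (0 : ℝ) < b := by exact_mod_cast hb
  have hr : 0 < renorm b := by unfold renorm; positivity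
  refine iSup_le fun ℓ => ?_
  calc ENNReal.ofReal (levelEnergy ℓ (f ∘ F i))
      ≤ ENNReal.ofReal (renorm b * levelEnergy (ℓ + 1) f) := by
        refine ENNReal.ofReal_le_ofReal ?_
        rw [levelEnergy_succ, mul_inv_cancel_left₀ hr.ne']
        exact Finset.single_le_sum (f := fun i => levelEnergy ℓ (f ∘ F i))
          (fun i _ => levelEnergy_nonneg ℓ _) (Finset.mem_univ i)
    _ = ENNReal.ofReal (renorm b) * ENNReal.ofReal (levelEnergy (ℓ + 1) f) :=
        ENNReal.ofReal_mul hr.le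
    _ ≤ _ := by gcongr; exact le_iSup (fun ℓ => ENNReal.ofReal (levelEnergy ℓ f)) (ℓ + 1)

/-- `F_i` contracts the resistance metric, so that it extends continuously to `K_b`. -/
lemma uniformContinuous_F (hb : 1 ≤ b) (i : Fin (b + 2)) :
    UniformContinuous (F i : Vert b → Vert b) := by
  have : LipschitzWith (renorm b).toNNReal (F i : Vert b → Vert b) := by
    intro x y
    change resistance (F i x) (F i y) ≤ ENNReal.ofReal (renorm b) * resistance x y
    have hb' : (0 : ℝ) < b := by exact_mod_cast hb
    have hr : 0 < renorm b := by unfold renorm; positivity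
    conv_rhs => rw [resistance, sInf_eq_iInf]
    rw [ENNReal.mul_iInf_of_ne (by simpa using hr) ENNReal.ofReal_ne_top]
    refine le_iInf fun A => ?_
    rw [ENNReal.mul_iInf_of_ne (by simpa using hr) ENNReal.ofReal_ne_top]
    refine le_iInf fun hA => sInf_le fun f hf => ?_
    have hle := energy_comp_F_le hb i f
    refine (hA (f ∘ F i) (hle.trans_lt (ENNReal.mul_lt_top ENNReal.ofReal_lt_top hf))).trans ?_
    rw [mul_comm (ENNReal.ofReal _) A, mul_assoc]
    gcongr
  exact this.uniformContinuous

/-- The continuous extension `F_i : K_b → K_b`. -/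
noncomputable def FK (i : Fin (b + 2)) : K b → K b := UniformSpace.Completion.map (F i)

/-- `μ` is the self-similar measure on `K_b`: a Borel measure with `μ(K_b) = 1` and
`μ(A) = (b + 2)⁻¹ ∑ μ(F_i⁻¹ A)`. -/
def IsSelfSimilarMeasure (μ : Measure (K b)) : Prop :=
  μ Set.univ = 1 ∧ ∀ A : Set (K b), MeasurableSet A →
    μ A = (b + 2 : ℝ≥0∞)⁻¹ * ∑ i : Fin (b + 2), μ (FK i ⁻¹' A)

/-- The restriction to `V_*` of a continuous function on `K_b`. -/
noncomputable def res (u : C(K b, ℝ)) : Vert b → ℝ := fun x => u (x : K b)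

/-- `u` belongs to `dom ℰ`. Every function of finite energy on `V_*` is uniformly continuous for
the resistance metric, so `dom ℰ` is a space of continuous functions on `K_b`. -/
def InDomEnergy (u : C(K b, ℝ)) : Prop := energy (res u) < ∞

/-- `u ∈ dom Δ` and `Δ u = v`. -/
def HasLaplacian (μ : Measure (K b)) (u v : C(K b, ℝ)) : Prop :=
  InDomEnergy u ∧ ∀ g : C(K b, ℝ), InDomEnergy g → g (q 0) = 0 → g (q 1) = 0 →
    energyForm (res u) (res g) = - ∫ x, v x * g x ∂μ

/-- `f` is the multiharmonic function `f_{jk}`: it solves `Δ^{j+1} f = 0` with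
`Δ^m f (q_n) = δ_{jm} δ_{kn}`. Here `u m` is `Δ^m f`. -/
def IsMultiharmonic (μ : Measure (K b)) (j : ℕ) (k : Fin 2) (f : C(K b, ℝ)) : Prop :=
  ∃ u : ℕ → C(K b, ℝ), u 0 = f ∧ (∀ m ≤ j, HasLaplacian μ (u m) (u (m + 1))) ∧
    u (j + 1) = 0 ∧ ∀ m ≤ j, ∀ n : Fin 2, u m (q n) = if j = m ∧ k = n then 1 else 0

end BubbleDiamond

namespace BubbleDiamond

variable {b : ℕ}

/-! ### The energy as a bilinear form -/

/-! Everything rests on self-similarity. The energy satisfies `ℰ(f, g) = r⁻¹ ∑ ℰ(f ∘ F_i, g ∘ F_i)`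
(`energyForm_eq_sum_comp_F`) and the measure averages over the copies, so restricting to a copy
multiplies the Laplacian by `c = r / (b + 2)` (`HasLaplacian.comp_FKc`). Hence `f_{jk} ∘ F_i` is the
combination of the `c ^ l f_{ln}` with coefficients `f_{j-l,k}(F_i q_n)` (`comp_FKc_eq`).

The recursion comes from testing `Δ f_{j+1,k} = f_{jk}` against functions that vanish at `q₁`, `q₂`
and are harmonic on each copy (`HasLaplacian.level_one`). The energy side is a linear form in the
values of `f_{j+1,k}` at `p₁`, `p₂`, because the energy pairing with a harmonic function sees only
boundary values (`levelForm_harmonic`). The integral side expands into `a_l`, `b_l` and earlier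
values. The two test functions concentrated at `p₁` and `p₂` give a system with matrix `((b+1, -b),
(-b, b+1))` of determinant `2b + 1` (`recursion`), and the theorem is its solution. With right-hand
side zero the same test gives `p_0`, `q_0`; self-similarity of `∫ f₀₁²` together with `f₀₁ + f₀₂ =
1` gives `a_0`, `b_0`. The reflection exchanging `q₁` and `q₂` preserves energy and measure, so
nothing depends on `k`.

Existence has three sources. The maps contract by `r ≤ 1/2`, so `K_b` is compact and finite energy
functions extend to it. The measure is the limit of iterated averages of a point evaluation, turned
into a measure by Riesz–Markov. The Dirichlet problem is solved by the Riesz theorem in the space of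
finite energy functions vanishing on the boundary, and the `f_{jk}` follow by induction on `j`. -/

lemma renorm_pos (hb : 1 ≤ b) : 0 < renorm b := by
  have hb' : (0 : ℝ) < b := by exact_mod_cast hb
  unfold renorm; positivity

lemma renorm_le_half : renorm b ≤ 1 / 2 := by
  unfold renorm
  rw [div_le_div_iff₀ (by positivity) (by positivity)]
  linarith

/-- The polarization of `levelEnergy`. -/
noncomputable def levelForm (ℓ : ℕ) (f g : Vert b → ℝ) : ℝ :=
  (levelEnergy ℓ (f + g) - levelEnergy ℓ (f - g)) / 4

lemma levelForm_eq_sum (ℓ : ℕ) (f g : Vert b → ℝ) :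
    levelForm ℓ f g = (renorm b ^ ℓ)⁻¹ * ∑ w : Fin ℓ → Fin (b + 2),
      (f (Fword (List.ofFn w) (.bdry 0)) - f (Fword (List.ofFn w) (.bdry 1))) *
      (g (Fword (List.ofFn w) (.bdry 0)) - g (Fword (List.ofFn w) (.bdry 1))) := by
  unfold levelForm levelEnergy
  rw [← mul_sub, ← Finset.sum_sub_distrib, mul_div_assoc, Finset.sum_div]
  congr 1
  refine Finset.sum_congr rfl fun w _ => ?_
  simp only [Pi.add_apply, Pi.sub_apply]
  ring

lemma levelForm_self (ℓ : ℕ) (f : Vert b → ℝ) : levelForm ℓ f f = levelEnergy ℓ f := by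
  rw [levelForm_eq_sum, levelEnergy]
  simp only [sq]

lemma levelForm_comm (ℓ : ℕ) (f g : Vert b → ℝ) : levelForm ℓ f g = levelForm ℓ g f := by
  simp only [levelForm_eq_sum, mul_comm]

lemma levelForm_add_left (ℓ : ℕ) (f g h : Vert b → ℝ) :
    levelForm ℓ (f + g) h = levelForm ℓ f h + levelForm ℓ g h := by
  simp only [levelForm_eq_sum]
  rw [← mul_add, ← Finset.sum_add_distrib]
  congr 1
  refine Finset.sum_congr rfl fun w _ => ?_
  simp only [Pi.add_apply]
  ring

lemma levelForm_smul_left (ℓ : ℕ) (c : ℝ) (f h : Vert b → ℝ) :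
    levelForm ℓ (c • f) h = c * levelForm ℓ f h := by
  simp only [levelForm_eq_sum]
  rw [mul_left_comm, Finset.mul_sum (a := c)]
  congr 1
  refine Finset.sum_congr rfl fun w _ => ?_
  simp only [Pi.smul_apply, smul_eq_mul]
  ring

lemma levelForm_succ (ℓ : ℕ) (f g : Vert b → ℝ) :
    levelForm (ℓ + 1) f g = (renorm b)⁻¹ * ∑ i, levelForm ℓ (f ∘ F i) (g ∘ F i) := by
  unfold levelForm
  rw [levelEnergy_succ, levelEnergy_succ, ← mul_sub, ← Finset.sum_sub_distrib, mul_div_assoc,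
    Finset.sum_div]
  rfl

lemma levelForm_zero (f g : Vert b → ℝ) :
    levelForm 0 f g = (f (.bdry 0) - f (.bdry 1)) * (g (.bdry 0) - g (.bdry 1)) := by
  simp [levelForm_eq_sum, Fword]

/-- The parallelogram law, with the term of `f - g` dropped. -/
lemma levelEnergy_add_le (ℓ : ℕ) (f g : Vert b → ℝ) :
    levelEnergy ℓ (f + g) ≤ 2 * (levelEnergy ℓ f + levelEnergy ℓ g) := by
  have h := levelEnergy_nonneg ℓ (f - g)
  have e : levelEnergy ℓ (f + g) + levelEnergy ℓ (f - g)
      = 2 * (levelEnergy ℓ f + levelEnergy ℓ g) := by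
    unfold levelEnergy
    rw [← mul_add, ← mul_add, ← Finset.sum_add_distrib, ← Finset.sum_add_distrib,
      mul_left_comm, Finset.mul_sum (a := 2)]
    congr 1
    refine Finset.sum_congr rfl fun w _ => ?_
    simp only [Pi.add_apply, Pi.sub_apply]
    ring
  linarith

lemma levelEnergy_smul (ℓ : ℕ) (c : ℝ) (f : Vert b → ℝ) :
    levelEnergy ℓ (c • f) = c ^ 2 * levelEnergy ℓ f := by
  rw [← levelForm_self, levelForm_smul_left, levelForm_comm, levelForm_smul_left, levelForm_self]
  ring

lemma energy_lt_top_of_bound {f : Vert b → ℝ} {C : ℝ} (h : ∀ ℓ, levelEnergy ℓ f ≤ C) :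
    energy f < ∞ :=
  (iSup_le fun ℓ => ENNReal.ofReal_le_ofReal (h ℓ)).trans_lt ENNReal.ofReal_lt_top

lemma energy_toReal_le {f : Vert b → ℝ} {C : ℝ} (hC : 0 ≤ C) (h : ∀ ℓ, levelEnergy ℓ f ≤ C) :
    (energy f).toReal ≤ C :=
  ENNReal.toReal_le_of_le_ofReal hC (iSup_le fun ℓ => ENNReal.ofReal_le_ofReal (h ℓ))

lemma levelEnergy_le {f : Vert b → ℝ} (hf : energy f < ∞) (ℓ : ℕ) :
    levelEnergy ℓ f ≤ (energy f).toReal :=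
  (ENNReal.ofReal_le_iff_le_toReal hf.ne).1
    (le_iSup (fun ℓ => ENNReal.ofReal (levelEnergy ℓ f)) ℓ)

lemma energy_add_lt_top {f g : Vert b → ℝ} (hf : energy f < ∞) (hg : energy g < ∞) :
    energy (f + g) < ∞ :=
  energy_lt_top_of_bound (C := 2 * ((energy f).toReal + (energy g).toReal)) fun ℓ => by
    linarith [levelEnergy_add_le ℓ f g, levelEnergy_le hf ℓ, levelEnergy_le hg ℓ]

lemma energy_smul_lt_top (c : ℝ) {f : Vert b → ℝ} (hf : energy f < ∞) :
    energy (c • f) < ∞ :=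
  energy_lt_top_of_bound (C := c ^ 2 * (energy f).toReal) fun ℓ => by
    rw [levelEnergy_smul]
    exact mul_le_mul_of_nonneg_left (levelEnergy_le hf ℓ) (sq_nonneg c)

lemma energy_zero : energy (0 : Vert b → ℝ) = 0 := by
  simp [energy, levelEnergy]

/-- The space of functions of finite energy on `V_*`. -/
def finEnergy (b : ℕ) : Submodule ℝ (Vert b → ℝ) where
  carrier := {f | energy f < ∞}
  add_mem' := energy_add_lt_top
  zero_mem' := by simp [energy_zero]
  smul_mem' c _ hf := energy_smul_lt_top c hf

lemma mem_finEnergy {f : Vert b → ℝ} : f ∈ finEnergy b ↔ energy f < ∞ := Iff.rfl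

lemma tendsto_levelEnergy_toReal (hb : 1 ≤ b) {f : Vert b → ℝ} (hf : f ∈ finEnergy b) :
    Filter.Tendsto (fun ℓ => levelEnergy ℓ f) Filter.atTop (nhds (energy f).toReal) := by
  have := (ENNReal.tendsto_toReal (mem_finEnergy.1 hf).ne).comp (tendsto_levelEnergy hb f)
  refine this.congr fun ℓ => ?_
  simp [levelEnergy_nonneg]

/-- The polarization formula does not exhibit bilinearity of `energyForm`; it is inherited in the
limit from the level forms, which are finite sums of products. -/
lemma tendsto_levelForm (hb : 1 ≤ b) {f g : Vert b → ℝ} (hf : f ∈ finEnergy b)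
    (hg : g ∈ finEnergy b) :
    Filter.Tendsto (fun ℓ => levelForm ℓ f g) Filter.atTop (nhds (energyForm f g)) :=
  ((tendsto_levelEnergy_toReal hb (add_mem hf hg)).sub
    (tendsto_levelEnergy_toReal hb (sub_mem hf hg))).div_const 4

lemma energyForm_self (hb : 1 ≤ b) {f : Vert b → ℝ} (hf : f ∈ finEnergy b) :
    energyForm f f = (energy f).toReal :=
  tendsto_nhds_unique (tendsto_levelForm hb hf hf) <| by
    simpa only [levelForm_self] using tendsto_levelEnergy_toReal hb hf

lemma energyForm_comm (hb : 1 ≤ b) {f g : Vert b → ℝ} (hf : f ∈ finEnergy b)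
    (hg : g ∈ finEnergy b) : energyForm f g = energyForm g f :=
  tendsto_nhds_unique (tendsto_levelForm hb hf hg) <| by
    simpa only [levelForm_comm] using tendsto_levelForm hb hg hf

lemma energyForm_add_left (hb : 1 ≤ b) {f g h : Vert b → ℝ} (hf : f ∈ finEnergy b)
    (hg : g ∈ finEnergy b) (hh : h ∈ finEnergy b) :
    energyForm (f + g) h = energyForm f h + energyForm g h :=
  tendsto_nhds_unique (tendsto_levelForm hb (add_mem hf hg) hh) <| by
    simpa only [levelForm_add_left] using
      (tendsto_levelForm hb hf hh).add (tendsto_levelForm hb hg hh)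

lemma energyForm_smul_left (hb : 1 ≤ b) (c : ℝ) {f h : Vert b → ℝ} (hf : f ∈ finEnergy b)
    (hh : h ∈ finEnergy b) : energyForm (c • f) h = c * energyForm f h :=
  tendsto_nhds_unique (tendsto_levelForm hb (Submodule.smul_mem _ c hf) hh) <| by
    simpa only [levelForm_smul_left] using (tendsto_levelForm hb hf hh).const_mul c

lemma comp_F_mem (hb : 1 ≤ b) (i : Fin (b + 2)) {f : Vert b → ℝ} (hf : f ∈ finEnergy b) :
    f ∘ F i ∈ finEnergy b :=
  (energy_comp_F_le hb i f).trans_lt (ENNReal.mul_lt_top ENNReal.ofReal_lt_top hf)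

/-- Monotonicity replaces level `ℓ` by level `ℓ + 1`, which splits over the copies. This certifies
that glued functions have finite energy. -/
lemma mem_of_comp_F (hb : 1 ≤ b) {f : Vert b → ℝ} (hf : ∀ i, f ∘ F i ∈ finEnergy b) :
    f ∈ finEnergy b := by
  refine energy_lt_top_of_bound (C := (renorm b)⁻¹ * ∑ i, (energy (f ∘ F i)).toReal) fun ℓ =>
    (levelEnergy_le_succ hb ℓ f).trans ?_
  rw [levelEnergy_succ]
  have := (renorm_pos hb).le
  gcongr with i
  exact levelEnergy_le (hf i) ℓ

lemma energyForm_eq_sum_comp_F (hb : 1 ≤ b) {f g : Vert b → ℝ} (hf : f ∈ finEnergy b)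
    (hg : g ∈ finEnergy b) :
    energyForm f g = (renorm b)⁻¹ * ∑ i, energyForm (f ∘ F i) (g ∘ F i) :=
  tendsto_nhds_unique ((Filter.tendsto_add_atTop_iff_nat 1).2 (tendsto_levelForm hb hf hg)) <| by
    simp only [levelForm_succ]
    exact (tendsto_finsetSum _ fun i _ =>
      tendsto_levelForm hb (comp_F_mem hb i hf) (comp_F_mem hb i hg)).const_mul _

/-! ### Gluing functions on the copies -/

/-- The function with prescribed values on `V_1` and prescribed restrictions to the copies. -/
def glue (α β : Fin 2 → ℝ) (g : Fin (b + 2) → Vert b → ℝ) : Vert b → ℝ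
  | .bdry k => α k
  | .inner [] k => β k
  | .inner (i :: w) k => g i (.inner w k)

lemma glue_comp_F {α β : Fin 2 → ℝ} {g : Fin (b + 2) → Vert b → ℝ} (i : Fin (b + 2))
    (h : ∀ k, g i (.bdry k) = glue α β g (F i (.bdry k))) : glue α β g ∘ F i = g i := by
  funext x
  cases x with
  | bdry k => exact (h k).symm
  | inner w k => rfl

/-! ### Harmonic functions -/

/-- The values on the two inner vertices of `G_1` of the harmonic function with boundary
values `α`. -/
noncomputable def innerValue (b : ℕ) (α : Fin 2 → ℝ) (k : Fin 2) : ℝ :=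
  ((b + 1) * α k + b * α (1 - k)) / (2 * b + 1)

/-- The boundary values of the restrictions of a function on `V_1` to the copies. -/
def cellValue (α β : Fin 2 → ℝ) (i : Fin (b + 2)) (k : Fin 2) : ℝ :=
  if (i : ℕ) < b then β k
  else if (i : ℕ) = b then (if k = 0 then α 0 else β 0)
  else (if k = 0 then β 1 else α 1)

/-- The values of the harmonic function on the inner vertices, by recursion on the word. -/
noncomputable def harmonicInner : List (Fin (b + 2)) → (Fin 2 → ℝ) → Fin 2 → ℝ
  | [], α, k => innerValue b α k
  | i :: w, α, k => harmonicInner w (cellValue α (innerValue b α) i) k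

/-- The harmonic function on `V_*` with boundary values `α`. -/
noncomputable def harmonic (α : Fin 2 → ℝ) : Vert b → ℝ
  | .bdry k => α k
  | .inner w k => harmonicInner w α k

lemma glue_F_bdry (α β : Fin 2 → ℝ) (g : Fin (b + 2) → Vert b → ℝ) (i : Fin (b + 2)) (k : Fin 2) :
    glue α β g (F i (.bdry k)) = cellValue α β i k := by
  simp only [F, cellValue]
  split_ifs <;> rfl

lemma harmonic_comp_F (α : Fin 2 → ℝ) (i : Fin (b + 2)) :
    (harmonic α : Vert b → ℝ) ∘ F i = harmonic (cellValue α (innerValue b α) i) := by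
  funext x
  cases x with
  | bdry k =>
    simp only [Function.comp, F, harmonic, cellValue]
    split_ifs <;> simp [harmonicInner]
  | inner w k => rfl

lemma sum_cellValue (α β : Fin 2 → ℝ) (g : Vert b → ℝ) :
    ∑ i, (cellValue α β i 0 - cellValue α β i 1) * (g (F i (.bdry 0)) - g (F i (.bdry 1)))
      = b * ((β 0 - β 1) * (g (.inner [] 0) - g (.inner [] 1)))
        + (α 0 - β 0) * (g (.bdry 0) - g (.inner [] 0))
        + (β 1 - α 1) * (g (.inner [] 1) - g (.bdry 1)) := by
  rw [sum_letters]
  simp [cellValue, F]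

/-- The current through `G_1` is conserved: for `β = innerValue b α` one has `α 0 - β 0 = b (β 0 - β
1) = β 1 - α 1 = r (α 0 - α 1)`. The differences of `g` therefore telescope and the factor `r`
cancels the renormalization. -/
lemma levelForm_harmonic (hb : 1 ≤ b) (ℓ : ℕ) (α : Fin 2 → ℝ) (g : Vert b → ℝ) :
    levelForm ℓ (harmonic α) g = (α 0 - α 1) * (g (.bdry 0) - g (.bdry 1)) := by
  induction ℓ generalizing α g with
  | zero => rw [levelForm_zero]; rfl
  | succ ℓ ih =>
    rw [levelForm_succ]
    simp only [harmonic_comp_F, ih, Function.comp]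
    rw [sum_cellValue]
    have hb' : (0 : ℝ) < b := by exact_mod_cast hb
    simp only [innerValue, renorm]
    simp only [sub_zero, sub_self]
    field_simp
    ring

lemma harmonic_mem (hb : 1 ≤ b) (α : Fin 2 → ℝ) : (harmonic α : Vert b → ℝ) ∈ finEnergy b :=
  energy_lt_top_of_bound fun ℓ => by
    rw [← levelForm_self, levelForm_harmonic hb]

lemma energyForm_harmonic (hb : 1 ≤ b) (α : Fin 2 → ℝ) {g : Vert b → ℝ} (hg : g ∈ finEnergy b) :
    energyForm (harmonic α) g = (α 0 - α 1) * (g (.bdry 0) - g (.bdry 1)) :=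
  tendsto_nhds_unique (tendsto_levelForm hb (harmonic_mem hb α) hg) <| by
    simp only [levelForm_harmonic hb]
    exact tendsto_const_nhds

/-! ### Resistance estimates -/

lemma edist_F_le (hb : 1 ≤ b) (i : Fin (b + 2)) (x y : Vert b) :
    edist (F i x) (F i y) ≤ ENNReal.ofReal (renorm b) * edist x y := by
  change resistance (F i x) (F i y) ≤ ENNReal.ofReal (renorm b) * resistance x y
  have hr := renorm_pos hb
  conv_rhs => rw [resistance, sInf_eq_iInf]
  rw [ENNReal.mul_iInf_of_ne (by simpa using hr) ENNReal.ofReal_ne_top]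
  refine le_iInf fun A => ?_
  rw [ENNReal.mul_iInf_of_ne (by simpa using hr) ENNReal.ofReal_ne_top]
  refine le_iInf fun hA => sInf_le fun f hf => ?_
  refine (hA (f ∘ F i) (comp_F_mem hb i hf)).trans ?_
  rw [mul_comm (ENNReal.ofReal _) A, mul_assoc]
  gcongr
  exact energy_comp_F_le hb i f

lemma edist_F_le_half (hb : 1 ≤ b) (i : Fin (b + 2)) (x y : Vert b) :
    edist (F i x) (F i y) ≤ 2⁻¹ * edist x y := by
  refine (edist_F_le hb i x y).trans ?_
  gcongr
  refine (ENNReal.ofReal_le_ofReal renorm_le_half).trans ?_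
  rw [one_div, ENNReal.ofReal_inv_of_pos two_pos, ENNReal.ofReal_ofNat]

lemma edist_bdry_le_one : edist (.bdry 0 : Vert b) (.bdry 1) ≤ 1 :=
  sInf_le fun f _ => by
    rw [one_mul, ← levelEnergy_zero]
    exact le_iSup (fun ℓ => ENNReal.ofReal (levelEnergy ℓ f)) 0

lemma edist_F_bdry_le_one (hb : 1 ≤ b) (i : Fin (b + 2)) (k n : Fin 2) :
    edist (F i (.bdry k)) (F i (.bdry n)) ≤ 1 := by
  refine (edist_F_le_half hb i _ _).trans ?_
  have h : edist (.bdry k : Vert b) (.bdry n) ≤ 1 := by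
    fin_cases k <;> fin_cases n
    · simp
    · exact edist_bdry_le_one
    · rw [edist_comm]; exact edist_bdry_le_one
    · simp
  calc (2⁻¹ : ℝ≥0∞) * edist (.bdry k : Vert b) (.bdry n) ≤ 1 * 1 :=
        mul_le_mul' (by simp) h
    _ = 1 := one_mul 1

/-- The point `F_i q₁` is one of `q₁`, `p₁`, `p₂`, and the path `q₁, p₁, p₂` has two steps of length
at most `1`. -/
lemma edist_F_bdry_zero (hb : 1 ≤ b) (i : Fin (b + 2)) :
    edist (F i (.bdry 0) : Vert b) (.bdry 0) ≤ 2 := by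
  have e0 : F (b := b) (Fin.last b).castSucc (.bdry 0) = .bdry 0 := by simp [F]
  have e1 : F (b := b) (Fin.last b).castSucc (.bdry 1) = .inner [] 0 := by simp [F]
  have e2 : F (b := b) ⟨0, by omega⟩ (.bdry 0) = .inner [] 0 := by
    simp only [F]; rw [if_pos (show 0 < b by omega)]
  have e3 : F (b := b) ⟨0, by omega⟩ (.bdry 1) = .inner [] 1 := by
    simp only [F]; rw [if_pos (show 0 < b by omega)]
  have h1 : edist (.inner [] 0 : Vert b) (.bdry 0) ≤ 1 := by
    rw [← e0, ← e1]; exact edist_F_bdry_le_one hb _ _ _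
  have h2 : edist (.inner [] 1 : Vert b) (.inner [] 0) ≤ 1 := by
    rw [← e2, ← e3]; exact edist_F_bdry_le_one hb _ _ _
  have h3 : edist (.inner [] 1 : Vert b) (.bdry 0) ≤ 2 :=
    (edist_triangle _ _ _).trans ((add_le_add h2 h1).trans (by norm_num))
  have h4 : edist (.inner [] 0 : Vert b) (.bdry 0) ≤ 2 := h1.trans (by norm_num)
  simp only [F]
  split_ifs <;> first | exact h3 | exact h4 | simp

/-- The constant `4` solves `D = D / 2 + 2`: a map `F_i` halves the distance to `q₁` and then
displaces `q₁` by at most `2`. -/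
lemma edist_bdry_zero_le (hb : 1 ≤ b) (x : Vert b) : edist x (.bdry 0) ≤ 4 := by
  have step : ∀ (i : Fin (b + 2)) (y : Vert b), edist y (.bdry 0) ≤ 4 →
      edist (F i y) (.bdry 0) ≤ 4 := fun i y hy => by
    refine (edist_triangle _ (F i (.bdry 0)) _).trans ?_
    refine (add_le_add ((edist_F_le_half hb i _ _).trans (mul_le_mul_right hy _))
      (edist_F_bdry_zero hb i)).trans ?_
    rw [show (4 : ℝ≥0∞) = 2 * 2 by norm_num, ← mul_assoc,
      ENNReal.inv_mul_cancel (by norm_num) (by norm_num)]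
    norm_num
  have hbd : ∀ k, edist (.bdry k : Vert b) (.bdry 0) ≤ 4 := fun k => by
    fin_cases k
    · simp
    · change edist (.bdry 1 : Vert b) (.bdry 0) ≤ 4
      rw [edist_comm]; exact edist_bdry_le_one.trans (by norm_num)
  cases x with
  | bdry k => exact hbd k
  | inner w k =>
    induction w with
    | nil =>
      have e : F (b := b) ⟨0, by omega⟩ (.bdry k) = .inner [] k := by
        simp only [F]; rw [if_pos (show 0 < b by omega)]
      rw [← e]; exact step _ _ (hbd k)
    | cons i w ih => exact step i (.inner w k) ih

lemma edist_le (hb : 1 ≤ b) (x y : Vert b) : edist x y ≤ 8 := by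
  refine (edist_triangle _ (.bdry 0) _).trans ?_
  rw [edist_comm _ y]
  exact (add_le_add (edist_bdry_zero_le hb x) (edist_bdry_zero_le hb y)).trans (by norm_num)

lemma edist_Fword_le (hb : 1 ≤ b) (w : List (Fin (b + 2))) (x y : Vert b) :
    edist (Fword w x) (Fword w y) ≤ 2⁻¹ ^ w.length * 8 := by
  induction w with
  | nil => simpa [Fword] using edist_le hb x y
  | cons i w ih =>
    refine (edist_F_le_half hb i _ _).trans ?_
    rw [List.length_cons, pow_succ', mul_assoc]
    exact mul_le_mul_right ih _

lemma sq_sub_le_edist_mul (hb : 1 ≤ b) {f : Vert b → ℝ} (hf : f ∈ finEnergy b) (x y : Vert b) :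
    ENNReal.ofReal ((f x - f y) ^ 2) ≤ edist x y * energy f := by
  -- The factor `energy f` can be moved inside the infimum only if it is nonzero. If it vanishes,
  -- any finite admissible constant suffices, and one exists because the diameter is finite.
  by_cases h0 : energy f = 0
  · have h : resistance x y < 9 := (edist_le hb x y).trans_lt (by norm_num)
    obtain ⟨A, hA, -⟩ := sInf_lt_iff.1 h
    simpa [h0] using hA f hf
  · change _ ≤ resistance x y * energy f
    rw [resistance, sInf_eq_iInf, ENNReal.iInf_mul_of_ne h0 hf.ne]
    refine le_iInf fun A => ?_
    rw [ENNReal.iInf_mul_of_ne h0 hf.ne]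
    exact le_iInf fun hA => hA f hf

lemma sq_sub_le (hb : 1 ≤ b) {f : Vert b → ℝ} (hf : f ∈ finEnergy b) (x y : Vert b) :
    (f x - f y) ^ 2 ≤ 8 * (energy f).toReal := by
  have h := (sq_sub_le_edist_mul hb hf x y).trans (mul_le_mul_left (edist_le hb x y) _)
  rw [← ENNReal.toReal_ofNat, ← ENNReal.toReal_mul]
  exact (ENNReal.ofReal_le_iff_le_toReal (ENNReal.mul_lt_top (by simp) hf).ne).1 h

lemma exists_F_eq (hb : 1 ≤ b) (x : Vert b) : ∃ i y, F i y = x := by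
  cases x with
  | bdry k =>
    fin_cases k
    · exact ⟨(Fin.last b).castSucc, .bdry 0, by simp [F]⟩
    · exact ⟨Fin.last (b + 1), .bdry 1, by simp [F]⟩
  | inner w k =>
    cases w with
    | nil => exact ⟨⟨0, by omega⟩, .bdry k, by simp only [F]; rw [if_pos (show 0 < b by omega)]⟩
    | cons i w => exact ⟨i, .inner w k, rfl⟩

lemma exists_Fword_eq (hb : 1 ≤ b) (m : ℕ) (x : Vert b) :
    ∃ w : List.Vector (Fin (b + 2)) m, ∃ y, Fword w.1 y = x := by
  induction m generalizing x with
  | zero => exact ⟨⟨[], rfl⟩, x, rfl⟩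
  | succ m ih =>
    obtain ⟨i, y, rfl⟩ := exists_F_eq hb x
    obtain ⟨w, z, rfl⟩ := ih y
    exact ⟨⟨i :: w.1, by simp [w.2]⟩, z, rfl⟩

/-! ### Topology of the fractal -/

lemma exists_half_pow_mul_lt {ε : ℝ≥0∞} (hε : 0 < ε) : ∃ m : ℕ, (2⁻¹ : ℝ≥0∞) ^ m * 8 < ε := by
  have h : Filter.Tendsto (fun m : ℕ => (2⁻¹ : ℝ≥0∞) ^ m * 8) Filter.atTop (nhds (0 * 8)) :=
    ENNReal.Tendsto.mul_const (ENNReal.tendsto_pow_atTop_nhds_zero_of_lt_one (by simp))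
      (Or.inr (by simp))
  rw [zero_mul] at h
  exact (h.eventually_lt_const hε).exists

/-- The cells of level `m` are finitely many, cover `V_*`, and have diameter at most `8 / 2 ^ m`, so
the points `F_w q₁` form a finite net. -/
lemma totallyBounded_vert (hb : 1 ≤ b) : TotallyBounded (Set.univ : Set (Vert b)) := by
  refine EMetric.totallyBounded_iff.2 fun ε hε => ?_
  obtain ⟨m, hm⟩ := exists_half_pow_mul_lt hε
  refine ⟨Set.range fun w : List.Vector (Fin (b + 2)) m => Fword w.1 (.bdry 0),
    Set.finite_range _, fun x _ => ?_⟩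
  obtain ⟨w, y, rfl⟩ := exists_Fword_eq hb m x
  refine Set.mem_iUnion₂.2 ⟨_, ⟨w, rfl⟩, (edist_Fword_le hb w.1 y _).trans_lt ?_⟩
  rwa [w.2]

lemma compactSpace_K (hb : 1 ≤ b) : CompactSpace (K b) := by
  refine ⟨?_⟩
  have h := ((totallyBounded_vert hb).image
    (UniformSpace.Completion.uniformContinuous_coe (Vert b))).closure
  rw [Set.image_univ, UniformSpace.Completion.denseRange_coe.closure_range] at h
  exact h.isCompact_of_isClosed isClosed_univ

lemma metrizableSpace_K (hb : 1 ≤ b) : TopologicalSpace.MetrizableSpace (K b) := by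
  let : PseudoMetricSpace (Vert b) := PseudoEMetricSpace.toPseudoMetricSpace fun x y =>
    ((edist_le hb x y).trans_lt (by norm_num : (8 : ℝ≥0∞) < ∞)).ne
  exact (inferInstance : TopologicalSpace.MetrizableSpace (UniformSpace.Completion (Vert b)))

/-- `F_i` as a continuous map of `K_b`. -/
noncomputable def FKc (i : Fin (b + 2)) : C(K b, K b) :=
  ⟨FK i, UniformSpace.Completion.continuous_map⟩

lemma FKc_coe (hb : 1 ≤ b) (i : Fin (b + 2)) (x : Vert b) :
    FKc i (x : K b) = ((F i x : Vert b) : K b) :=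
  UniformSpace.Completion.map_coe (uniformContinuous_F hb i) x

lemma res_comp_FKc (hb : 1 ≤ b) (i : Fin (b + 2)) (u : C(K b, ℝ)) :
    res (u.comp (FKc i)) = res u ∘ F i := by
  funext x
  exact congrArg u (FKc_coe hb i x)

lemma res_injective : Function.Injective (res : C(K b, ℝ) → Vert b → ℝ) := fun u v h =>
  ContinuousMap.ext fun x =>
    UniformSpace.Completion.induction_on x (isClosed_eq u.continuous v.continuous) (congrFun h)

lemma res_add (u v : C(K b, ℝ)) : res (u + v) = res u + res v := rfl

lemma res_sub (u v : C(K b, ℝ)) : res (u - v) = res u - res v := rfl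

lemma res_smul (c : ℝ) (u : C(K b, ℝ)) : res (c • u) = c • res u := rfl

/-- This is the Hölder bound `|f x - f y|² ≤ R(x, y) ℰ(f)`. -/
lemma uniformContinuous_of_mem (hb : 1 ≤ b) {f : Vert b → ℝ} (hf : f ∈ finEnergy b) :
    UniformContinuous f := by
  refine EMetric.uniformContinuous_iff.2 fun ε hε => ?_
  obtain ⟨η, hη, hηε⟩ : ∃ η : ℝ, 0 < η ∧ ENNReal.ofReal η < ε := by
    obtain ⟨c, hc, hcε⟩ := ENNReal.lt_iff_exists_nnreal_btwn.1 hε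
    exact ⟨c, by simpa using hc, by simpa using hcε⟩
  -- The summand `1` keeps the denominator positive when the energy vanishes.
  have hE : 0 < (energy f).toReal + 1 := by positivity
  refine ⟨ENNReal.ofReal (η ^ 2 / ((energy f).toReal + 1)), by simpa using by positivity,
    fun {x y} hxy => lt_of_le_of_lt ?_ hηε⟩
  rw [edist_dist, Real.dist_eq]
  refine ENNReal.ofReal_le_ofReal (abs_le_of_sq_le_sq ?_ hη.le)
  have h := (sq_sub_le_edist_mul hb hf x y).trans
    (mul_le_mul' hxy.le (ENNReal.ofReal_toReal (mem_finEnergy.1 hf).ne).ge)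
  rw [← ENNReal.ofReal_mul (by positivity), ENNReal.ofReal_le_ofReal_iff (by positivity)] at h
  refine h.trans ?_
  rw [div_mul_eq_mul_div, div_le_iff₀ hE]
  nlinarith [sq_nonneg η]

lemma exists_res_eq (hb : 1 ≤ b) {f : Vert b → ℝ} (hf : f ∈ finEnergy b) :
    ∃ u : C(K b, ℝ), res u = f :=
  ⟨⟨UniformSpace.Completion.extension f, UniformSpace.Completion.continuous_extension⟩,
    funext fun x => UniformSpace.Completion.extension_coe (uniformContinuous_of_mem hb hf) x⟩

lemma forall_K_le {u : C(K b, ℝ)} {C : ℝ} (h : ∀ x : Vert b, |u x| ≤ C) (x : K b) : |u x| ≤ C :=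
  UniformSpace.Completion.induction_on x (isClosed_le (by fun_prop) continuous_const) h

/-! ### The self-similar measure -/

/-- The oscillation of `φ` on the cells of level `m` is at most `ε`. -/
def OscLE (m : ℕ) (φ : C(K b, ℝ)) (ε : ℝ) : Prop :=
  ∀ w : List (Fin (b + 2)), w.length = m → ∀ x y : Vert b,
    |φ (Fword w x : Vert b) - φ (Fword w y : Vert b)| ≤ ε

lemma exists_oscLE (hb : 1 ≤ b) (φ : C(K b, ℝ)) {ε : ℝ} (hε : 0 < ε) : ∃ m, OscLE m φ ε := by
  have := compactSpace_K hb
  have hφ : UniformContinuous fun x : Vert b => φ x :=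
    (CompactSpace.uniformContinuous_of_continuous φ.continuous).comp
      (UniformSpace.Completion.uniformContinuous_coe (Vert b))
  obtain ⟨δ, hδ, h⟩ := EMetric.uniformContinuous_iff.1 hφ (ENNReal.ofReal ε) (by simpa)
  obtain ⟨m, hm⟩ := exists_half_pow_mul_lt hδ
  refine ⟨m, fun w hw x y => ?_⟩
  have := (h ((edist_Fword_le hb w x y).trans_lt (hw ▸ hm))).le
  rwa [edist_dist, Real.dist_eq, ENNReal.ofReal_le_ofReal_iff hε.le] at this

lemma OscLE.comp (hb : 1 ≤ b) {m : ℕ} {φ : C(K b, ℝ)} {ε : ℝ} (h : OscLE (m + 1) φ ε)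
    (i : Fin (b + 2)) : OscLE m (φ.comp (FKc i)) ε := fun w hw x y => by
  simp only [ContinuousMap.comp_apply, FKc_coe hb]
  exact h (i :: w) (by simp [hw]) x y

/-- Normalized positive linear functionals on `C(K_b)`. -/
def IsMean (T : C(K b, ℝ) →ₗ[ℝ] ℝ) : Prop := T 1 = 1 ∧ ∀ φ, 0 ≤ φ → 0 ≤ T φ

/-- The dual of the self-similarity operator acting on functionals. -/
noncomputable def average (T : C(K b, ℝ) →ₗ[ℝ] ℝ) : C(K b, ℝ) →ₗ[ℝ] ℝ :=
  (b + 2 : ℝ)⁻¹ • ∑ i, T ∘ₗ (ContinuousMap.compRightAlgHom ℝ ℝ (FKc i)).toLinearMap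

lemma average_apply (T : C(K b, ℝ) →ₗ[ℝ] ℝ) (φ : C(K b, ℝ)) :
    average T φ = (b + 2 : ℝ)⁻¹ * ∑ i, T (φ.comp (FKc i)) := by
  simp [average, ContinuousMap.compRightAlgHom]

lemma IsMean.average {T : C(K b, ℝ) →ₗ[ℝ] ℝ} (hT : IsMean T) : IsMean (average T) := by
  refine ⟨?_, fun φ hφ => ?_⟩
  · have h : ∀ i, (1 : C(K b, ℝ)).comp (FKc i) = 1 := fun i => rfl
    have : (b + 2 : ℝ) ≠ 0 := by positivity
    simp [average_apply, h, hT.1, this]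
  · rw [average_apply]
    have := Finset.sum_nonneg fun i (_ : i ∈ Finset.univ) =>
      hT.2 (φ.comp (FKc i)) fun x => hφ (FKc i x)
    positivity

lemma IsMean.iterate {T : C(K b, ℝ) →ₗ[ℝ] ℝ} (hT : IsMean T) (m : ℕ) :
    IsMean (BubbleDiamond.average^[m] T) := by
  induction m with
  | zero => exact hT
  | succ m ih => rw [Function.iterate_succ_apply']; exact ih.average

lemma IsMean.mono {T : C(K b, ℝ) →ₗ[ℝ] ℝ} (hT : IsMean T) {φ ψ : C(K b, ℝ)} (h : φ ≤ ψ) :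
    T φ ≤ T ψ := by
  have := hT.2 (ψ - φ) (sub_nonneg.2 h)
  rw [map_sub] at this
  linarith

lemma IsMean.abs_sub_le {T : C(K b, ℝ) →ₗ[ℝ] ℝ} (hT : IsMean T) {φ : C(K b, ℝ)} {c ε : ℝ}
    (h : ∀ x : Vert b, |φ x - c| ≤ ε) : |T φ - c| ≤ ε := by
  have hK := forall_K_le (u := φ - c • 1) (by simpa using h)
  have hc : ∀ a : ℝ, T (a • 1) = a := fun a => by rw [map_smul, hT.1]; simp
  have h1 := hT.mono (φ := φ) (ψ := (c + ε) • 1) fun x => by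
    have := (abs_le.1 (hK x)).2
    simp at this ⊢
    linarith
  have h2 := hT.mono (φ := (c - ε) • 1) (ψ := φ) fun x => by
    have := (abs_le.1 (hK x)).1
    simp at this ⊢
    linarith
  rw [hc] at h1 h2
  exact abs_le.2 ⟨by linarith, by linarith⟩

/-- After `m` averagings a mean only sees `φ` on cells of level `m`, where it is constant up to `ε`;
at the bottom both means are compared with `φ (F_w q₁)`. This one estimate yields existence and
uniqueness of the measure. -/
lemma IsMean.abs_iterate_sub_le (hb : 1 ≤ b) {T T' : C(K b, ℝ) →ₗ[ℝ] ℝ} (hT : IsMean T)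
    (hT' : IsMean T') (m : ℕ) {φ : C(K b, ℝ)} {ε : ℝ} (h : OscLE m φ ε) :
    |BubbleDiamond.average^[m] T φ - BubbleDiamond.average^[m] T' φ| ≤ 2 * ε := by
  induction m generalizing φ with
  | zero =>
    have h0 : ∀ x : Vert b, |φ x - φ (q 0)| ≤ ε := fun x => h [] rfl x (.bdry 0)
    have h1 := abs_le.1 (hT.abs_sub_le h0)
    have h2 := abs_le.1 (hT'.abs_sub_le h0)
    exact abs_le.2 ⟨by simp; linarith, by simp; linarith⟩
  | succ m ih =>
    rw [Function.iterate_succ_apply', Function.iterate_succ_apply', average_apply, average_apply,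
      ← mul_sub, ← Finset.sum_sub_distrib, abs_mul, abs_of_pos (by positivity),
      inv_mul_le_iff₀ (by positivity)]
    refine (Finset.abs_sum_le_sum_abs _ _).trans
      ((Finset.sum_le_card_nsmul _ _ (2 * ε) fun i _ => ih (h.comp hb i)).trans ?_)
    simp

/-- Evaluation at `q₁`. -/
noncomputable def evalMean (b : ℕ) : C(K b, ℝ) →ₗ[ℝ] ℝ where
  toFun φ := φ (q 0)
  map_add' _ _ := rfl
  map_smul' _ _ := rfl

lemma isMean_evalMean : IsMean (evalMean b) := ⟨rfl, fun _ h => h (q 0)⟩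

lemma exists_average_eq (hb : 1 ≤ b) :
    ∃ T : C(K b, ℝ) →ₗ[ℝ] ℝ, IsMean T ∧ average T = T := by
  have hc : ∀ φ : C(K b, ℝ), ∃ l,
      Filter.Tendsto (fun n => average^[n] (evalMean b) φ) Filter.atTop (nhds l) := fun φ => by
    refine cauchySeq_tendsto_of_complete (Metric.cauchySeq_iff'.2 fun ε hε => ?_)
    obtain ⟨m, hm⟩ := exists_oscLE hb φ (show 0 < ε / 4 by positivity)
    refine ⟨m, fun n hn => ?_⟩
    obtain ⟨k, rfl⟩ := Nat.exists_eq_add_of_le hn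
    -- The iterate `m + k` is the `m`-th iterate started at another mean, so the previous estimate
    -- gives the Cauchy property.
    rw [Function.iterate_add_apply, Real.dist_eq]
    have := (isMean_evalMean.iterate k).abs_iterate_sub_le hb isMean_evalMean m hm
    linarith
  choose T hT using hc
  let L : C(K b, ℝ) →ₗ[ℝ] ℝ := linearMapOfTendsto T (fun n => average^[n] (evalMean b))
    (tendsto_pi_nhds.2 hT)
  refine ⟨L, ⟨?_, fun φ hφ => ?_⟩, LinearMap.ext fun φ => ?_⟩
  · refine tendsto_nhds_unique (hT 1) ?_
    simp only [(isMean_evalMean.iterate _).1, tendsto_const_nhds]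
  · exact ge_of_tendsto' (hT φ) fun n => (isMean_evalMean.iterate n).2 φ hφ
  · refine tendsto_nhds_unique ?_ ((Filter.tendsto_add_atTop_iff_nat 1).2 (hT φ))
    simp only [Function.iterate_succ_apply', average_apply]
    exact (tendsto_finsetSum _ fun i _ => hT _).const_mul _

lemma measurable_FK (i : Fin (b + 2)) : Measurable (FK i : K b → K b) :=
  (FKc i).continuous.measurable

lemma isSelfSimilarMeasure_iff {μ : Measure (K b)} : IsSelfSimilarMeasure μ ↔
    μ Set.univ = 1 ∧ μ = (b + 2 : ℝ≥0∞)⁻¹ • ∑ i, μ.map (FK i) := by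
  refine and_congr_right fun _ => ⟨fun h => Measure.ext fun A hA => ?_, fun h A hA => ?_⟩
  · rw [h A hA]
    simp [Measure.map_apply (measurable_FK _) hA]
  · conv_lhs => rw [h]
    simp [Measure.map_apply (measurable_FK _) hA]

lemma IsSelfSimilarMeasure.isProbabilityMeasure {μ : Measure (K b)}
    (hμ : IsSelfSimilarMeasure μ) : IsProbabilityMeasure μ := ⟨hμ.1⟩

lemma integrable_K (hb : 1 ≤ b) {μ : Measure (K b)} [IsFiniteMeasure μ] (φ : C(K b, ℝ)) :
    Integrable φ μ := by
  have := compactSpace_K hb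
  have := metrizableSpace_K hb
  exact φ.continuous.integrable_of_hasCompactSupport (HasCompactSupport.of_compactSpace _)

lemma integral_average (hb : 1 ≤ b) (μ : Measure (K b)) [IsFiniteMeasure μ] (φ : C(K b, ℝ)) :
    ∫ x, φ x ∂((b + 2 : ℝ≥0∞)⁻¹ • ∑ i, μ.map (FK i))
      = (b + 2 : ℝ)⁻¹ * ∑ i, ∫ x, φ.comp (FKc i) x ∂μ := by
  rw [integral_smul_measure, integral_finsetSum_measure fun i _ => integrable_K hb φ, smul_eq_mul]
  congr 1
  · rw [ENNReal.toReal_inv, ENNReal.toReal_add (by simp) (by simp)]; simp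
  · refine Finset.sum_congr rfl fun i _ => ?_
    have := compactSpace_K hb
    have := metrizableSpace_K hb
    rw [integral_map (measurable_FK i).aemeasurable φ.continuous.aestronglyMeasurable]
    rfl

lemma IsSelfSimilarMeasure.integral_eq (hb : 1 ≤ b) {μ : Measure (K b)}
    (hμ : IsSelfSimilarMeasure μ) (φ : C(K b, ℝ)) :
    ∫ x, φ x ∂μ = (b + 2 : ℝ)⁻¹ * ∑ i, ∫ x, φ.comp (FKc i) x ∂μ := by
  have := hμ.isProbabilityMeasure
  rw [← integral_average hb]
  exact congrArg (fun ν => ∫ x, φ x ∂ν) (isSelfSimilarMeasure_iff.1 hμ).2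

lemma measure_ext (hb : 1 ≤ b) {μ ν : Measure (K b)} [IsFiniteMeasure μ] [IsFiniteMeasure ν]
    (h : ∀ φ : C(K b, ℝ), ∫ x, φ x ∂μ = ∫ x, φ x ∂ν) : μ = ν := by
  have := metrizableSpace_K hb
  let := TopologicalSpace.metrizableSpaceMetric (K b)
  exact ext_of_forall_integral_eq_of_IsFiniteMeasure fun f => h f.toContinuousMap

/-- Integration as a functional. -/
noncomputable def integralMean (hb : 1 ≤ b) (μ : Measure (K b)) [IsFiniteMeasure μ] :
    C(K b, ℝ) →ₗ[ℝ] ℝ where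
  toFun φ := ∫ x, φ x ∂μ
  map_add' φ ψ := integral_add (integrable_K hb φ) (integrable_K hb ψ)
  map_smul' c _ := integral_const_mul c _

lemma IsSelfSimilarMeasure.unique (hb : 1 ≤ b) {μ ν : Measure (K b)}
    (hμ : IsSelfSimilarMeasure μ) (hν : IsSelfSimilarMeasure ν) : μ = ν := by
  have := hμ.isProbabilityMeasure
  have := hν.isProbabilityMeasure
  have key : ∀ {μ : Measure (K b)} (_ : IsSelfSimilarMeasure μ) [IsProbabilityMeasure μ],
      IsMean (integralMean hb μ) ∧ ∀ m, average^[m] (integralMean hb μ) = integralMean hb μ := by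
    intro μ hμ _
    -- Integration against a self-similar measure is a mean fixed by `average`, so two such
    -- functionals agree up to arbitrarily small error.
    refine ⟨⟨by simp [integralMean], fun _ hφ => integral_nonneg hφ⟩, fun m => ?_⟩
    refine Function.iterate_fixed (LinearMap.ext fun φ => ?_) m
    rw [average_apply]
    exact (hμ.integral_eq hb φ).symm
  refine measure_ext hb fun φ => eq_of_forall_dist_le fun ε hε => ?_
  obtain ⟨m, hm⟩ := exists_oscLE hb φ (half_pos hε)
  have h := (key hμ).1.abs_iterate_sub_le hb (key hν).1 m hm
  rw [(key hμ).2, (key hν).2, mul_div_cancel₀ _ two_ne_zero] at h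
  exact h

lemma exists_isSelfSimilarMeasure (hb : 1 ≤ b) :
    ∃ μ : Measure (K b), IsSelfSimilarMeasure μ := by
  have := compactSpace_K hb
  obtain ⟨T, hT, hav⟩ := exists_average_eq hb
  let Λ : CompactlySupportedContinuousMap (K b) ℝ →ₚ[ℝ] ℝ := PositiveLinearMap.mk₀
    { toFun := fun φ => T φ.toContinuousMap
      map_add' := fun φ ψ => map_add T φ.toContinuousMap ψ.toContinuousMap
      map_smul' := fun c φ => map_smul T c φ.toContinuousMap }
    fun φ hφ => hT.2 _ hφ
  have hint : ∀ φ : C(K b, ℝ), ∫ x, φ x ∂(RealRMK.rieszMeasure Λ) = T φ := fun φ =>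
    RealRMK.integral_rieszMeasure Λ ⟨φ, HasCompactSupport.of_compactSpace _⟩
  have huniv : RealRMK.rieszMeasure Λ Set.univ = 1 := by
    have h := hint 1
    rw [hT.1] at h
    simpa [Measure.real, ENNReal.toReal_eq_one_iff] using h
  have : IsProbabilityMeasure (RealRMK.rieszMeasure Λ) := ⟨huniv⟩
  refine ⟨RealRMK.rieszMeasure Λ, isSelfSimilarMeasure_iff.2 ⟨huniv, ?_⟩⟩
  have : IsFiniteMeasure ((b + 2 : ℝ≥0∞)⁻¹ • ∑ i, (RealRMK.rieszMeasure Λ).map (FK i)) :=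
    Measure.smul_finite _ (by simp)
  refine measure_ext hb fun φ => ?_
  rw [integral_average hb, hint]
  simp only [hint]
  rw [← average_apply, hav]

end BubbleDiamond

/-- The Riesz representation theorem for a complete positive definite symmetric bilinear form. -/
lemma LinearMap.exists_eq_of_complete {V : Type*} [AddCommGroup V] [Module ℝ V]
    (B : V →ₗ[ℝ] V →ₗ[ℝ] ℝ) (hsymm : ∀ x y, B x y = B y x) (hnonneg : ∀ x, 0 ≤ B x x)
    (hdef : ∀ x, B x x = 0 → x = 0)
    (hcomplete : ∀ u : ℕ → V,
      (∀ ε > 0, ∃ N, ∀ m ≥ N, ∀ n ≥ N, B (u m - u n) (u m - u n) < ε) →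
      ∃ x, ∀ ε > 0, ∃ N, ∀ n ≥ N, B (u n - x) (u n - x) < ε)
    (L : V →ₗ[ℝ] ℝ) {C : ℝ} (hL : ∀ x, (L x) ^ 2 ≤ C ^ 2 * B x x) :
    ∃ u, ∀ g, B u g = L g := by
  let core : InnerProductSpace.Core ℝ V :=
    { inner := fun x y => B x y
      conj_inner_symm := fun x y => hsymm y x
      re_inner_nonneg := fun x => hnonneg x
      add_left := fun x y z => by rw [map_add]; rfl
      smul_left := fun x y c => by rw [map_smul]; rfl
      definite := hdef }
  let : NormedAddCommGroup V := core.toNormedAddCommGroup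
  let : InnerProductSpace ℝ V := InnerProductSpace.ofCore core.toCore
  have hin : ∀ x y : V, inner ℝ x y = B x y := fun x y => rfl
  have hnorm : ∀ x : V, ‖x‖ ^ 2 = B x x := fun x => by
    rw [← hin, real_inner_self_eq_norm_sq]
  have hlt : ∀ (x : V) {ε : ℝ}, 0 < ε → (‖x‖ < ε ↔ B x x < ε ^ 2) := fun x ε hε => by
    rw [← hnorm]
    exact (sq_lt_sq₀ (norm_nonneg x) hε.le).symm
  have : CompleteSpace V := by
    refine Metric.complete_of_cauchySeq_tendsto fun u hu => ?_
    obtain ⟨x, hx⟩ := hcomplete u fun ε hε => by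
      obtain ⟨N, hN⟩ := Metric.cauchySeq_iff.1 hu (√ε) (Real.sqrt_pos.2 hε)
      refine ⟨N, fun m hm n hn => ?_⟩
      have := hN m hm n hn
      rwa [dist_eq_norm, hlt _ (Real.sqrt_pos.2 hε), Real.sq_sqrt hε.le] at this
    refine ⟨x, Metric.tendsto_atTop.2 fun ε hε => ?_⟩
    obtain ⟨N, hN⟩ := hx (ε ^ 2) (by positivity)
    exact ⟨N, fun n hn => by rw [dist_eq_norm, hlt _ hε]; exact hN n hn⟩
  -- The hypothesis only involves `C ^ 2`, so `C` may be negative.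
  let L' : V →L[ℝ] ℝ := L.mkContinuous |C| fun x => by
    refine abs_le_of_sq_le_sq ?_ (by positivity)
    rw [mul_pow, sq_abs, hnorm]
    exact hL x
  refine ⟨(InnerProductSpace.toDual ℝ V).symm L', fun g => ?_⟩
  rw [← hin]
  exact InnerProductSpace.toDual_symm_apply

namespace BubbleDiamond

variable {b : ℕ}

/-! ### The Dirichlet problem -/

/-- The functions in `dom ℰ` that vanish on the boundary. -/
def domZero (b : ℕ) : Submodule ℝ C(K b, ℝ) where
  carrier := {u | res u ∈ finEnergy b ∧ u (q 0) = 0 ∧ u (q 1) = 0}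
  add_mem' hu hv := ⟨add_mem hu.1 hv.1, by simp [hu.2.1, hv.2.1], by simp [hu.2.2, hv.2.2]⟩
  zero_mem' := ⟨zero_mem (finEnergy b), rfl, rfl⟩
  smul_mem' c _ hu :=
    ⟨Submodule.smul_mem _ c hu.1, by simp [hu.2.1], by simp [hu.2.2]⟩

/-- The energy as a bilinear form on `domZero`. -/
noncomputable def energyZero (hb : 1 ≤ b) : domZero b →ₗ[ℝ] domZero b →ₗ[ℝ] ℝ :=
  LinearMap.mk₂ ℝ (fun u v => energyForm (res u.1) (res v.1))
    (fun u v w => energyForm_add_left hb u.2.1 v.2.1 w.2.1)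
    (fun c u v => energyForm_smul_left hb c u.2.1 v.2.1)
    (fun u v w => by
      rw [energyForm_comm hb u.2.1 (v + w).2.1, energyForm_comm hb u.2.1 v.2.1,
        energyForm_comm hb u.2.1 w.2.1]
      exact energyForm_add_left hb v.2.1 w.2.1 u.2.1)
    (fun c u v => by
      rw [energyForm_comm hb u.2.1 (c • v).2.1, energyForm_comm hb u.2.1 v.2.1]
      exact energyForm_smul_left hb c v.2.1 u.2.1)

lemma energyZero_self (hb : 1 ≤ b) (u : domZero b) :
    energyZero hb u u = (energy (res u.1)).toReal := energyForm_self hb u.2.1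

lemma sq_le_energyZero (hb : 1 ≤ b) (u : domZero b) (x : Vert b) :
    (u.1 x) ^ 2 ≤ 8 * energyZero hb u u := by
  have h := sq_sub_le hb u.2.1 x (.bdry 0)
  rw [← energyZero_self hb] at h
  have h0 : res u.1 (.bdry 0) = 0 := u.2.2.1
  rwa [h0, sub_zero] at h

lemma levelEnergy_continuous (ℓ : ℕ) : Continuous (levelEnergy ℓ : (Vert b → ℝ) → ℝ) := by
  unfold levelEnergy
  fun_prop

/-- Evaluations are controlled by the energy, so a Cauchy sequence converges pointwise. Each level
energy is continuous for pointwise convergence, hence the Cauchy bound passes to the limit uniformly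
in the level. -/
lemma energyZero_complete (hb : 1 ≤ b) (u : ℕ → domZero b)
    (hu : ∀ ε > 0, ∃ N, ∀ m ≥ N, ∀ n ≥ N, energyZero hb (u m - u n) (u m - u n) < ε) :
    ∃ x, ∀ ε > 0, ∃ N, ∀ n ≥ N, energyZero hb (u n - x) (u n - x) < ε := by
  have hpt : ∀ x : Vert b, ∃ l, Filter.Tendsto (fun n => (u n).1 x) Filter.atTop (nhds l) := by
    refine fun x => cauchySeq_tendsto_of_complete (Metric.cauchySeq_iff.2 fun ε hε => ?_)
    obtain ⟨N, hN⟩ := hu (ε ^ 2 / 8) (by positivity)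
    refine ⟨N, fun m hm n hn => ?_⟩
    have h1 := sq_le_energyZero hb (u m - u n) x
    have h2 := hN m hm n hn
    rw [Real.dist_eq]
    refine abs_lt_of_sq_lt_sq ?_ hε.le
    have h3 : (u m - u n).1 x = (u m).1 x - (u n).1 x := rfl
    rw [h3] at h1
    linarith
  choose f hf using hpt
  have hlim : Filter.Tendsto (fun n => res (u n).1) Filter.atTop (nhds f) := tendsto_pi_nhds.2 hf
  have hbound : ∀ ε > 0, ∃ N, ∀ n ≥ N, ∀ ℓ, levelEnergy ℓ (res (u n).1 - f) ≤ ε := by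
    intro ε hε
    obtain ⟨N, hN⟩ := hu ε hε
    refine ⟨N, fun n hn ℓ => ?_⟩
    refine le_of_tendsto (((levelEnergy_continuous ℓ).tendsto _).comp
      (tendsto_const_nhds.sub hlim)) ?_
    filter_upwards [Filter.eventually_ge_atTop N] with m hm
    refine (levelEnergy_le (u n - u m).2.1 ℓ).trans ?_
    rw [← energyZero_self hb]
    exact (hN n hn m hm).le
  have hmem : f ∈ finEnergy b := by
    obtain ⟨N, hN⟩ := hbound 1 one_pos
    have := sub_mem (u N).2.1 (energy_lt_top_of_bound (hN N le_rfl) :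
      res (u N).1 - f ∈ finEnergy b)
    rwa [sub_sub_cancel] at this
  obtain ⟨v, hv⟩ := exists_res_eq hb hmem
  have hbd : ∀ k, (∀ n, (u n).1 (q k) = 0) → v (q k) = 0 := fun k hk => by
    have : v (q k) = f (.bdry k) := congrFun hv _
    rw [this]
    refine tendsto_nhds_unique (hf _) ?_
    exact tendsto_const_nhds.congr fun n => (hk n).symm
  refine ⟨⟨v, by rw [hv]; exact hmem, hbd 0 fun n => (u n).2.2.1, hbd 1 fun n => (u n).2.2.2⟩,
    fun ε hε => ?_⟩
  obtain ⟨N, hN⟩ := hbound (ε / 2) (half_pos hε)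
  refine ⟨N, fun n hn => ?_⟩
  rw [energyZero_self hb]
  refine (energy_toReal_le (half_pos hε).le fun ℓ => ?_).trans_lt (half_lt_self hε)
  have e : res ((u n).1 - v) = res (u n).1 - f := by rw [res_sub, hv]
  exact e ▸ hN n hn ℓ

lemma exists_hasLaplacian (hb : 1 ≤ b) (μ : Measure (K b)) [IsProbabilityMeasure μ]
    (v : C(K b, ℝ)) : ∃ u, HasLaplacian μ u v ∧ ∀ k, u (q k) = 0 := by
  have := compactSpace_K hb
  let L : domZero b →ₗ[ℝ] ℝ :=
    { toFun := fun g => - ∫ x, v x * g.1 x ∂μ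
      map_add' := fun g h => by
        rw [← neg_add]
        refine congrArg Neg.neg (Eq.trans ?_
          (integral_add (integrable_K hb (v * g.1)) (integrable_K hb (v * h.1))))
        simp [mul_add]
      map_smul' := fun c g => by
        simp only [RingHom.id_apply, smul_eq_mul, mul_neg, ← integral_const_mul]
        simp [mul_left_comm] }
  obtain ⟨u, hu⟩ := (energyZero hb).exists_eq_of_complete
    (fun u v => energyForm_comm hb u.2.1 v.2.1)
    (fun u => by rw [energyZero_self]; positivity)
    (fun u h => Subtype.ext (res_injective (funext fun x => by
      have := sq_le_energyZero hb u x
      rw [h, mul_zero] at this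
      exact pow_eq_zero_iff two_ne_zero |>.1 (le_antisymm this (sq_nonneg _)))))
    -- The constant comes from `|g| ≤ √(8 ℰ(g))` and `μ` being a probability measure.
    (energyZero_complete hb) L (C := ‖v‖ * √8) (fun g => by
      have h0 : 0 ≤ energyZero hb g g := by rw [energyZero_self]; positivity
      have h1 : ∀ x, |g.1 x| ≤ √(8 * energyZero hb g g) := forall_K_le fun x =>
        Real.abs_le_sqrt (sq_le_energyZero hb g x)
      have h2 : ‖∫ x, v x * g.1 x ∂μ‖ ≤ ‖v‖ * √(8 * energyZero hb g g) := by
        have := norm_integral_le_of_norm_le_const (μ := μ) (f := fun x => v x * g.1 x)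
          (C := ‖v‖ * √(8 * energyZero hb g g)) (.of_forall fun x => by
            rw [norm_mul]
            exact mul_le_mul (v.norm_coe_le_norm x) (h1 x) (norm_nonneg _) (norm_nonneg _))
        simpa using this
      have h3 : (∫ x, v x * g.1 x ∂μ) ^ 2 ≤ (‖v‖ * √(8 * energyZero hb g g)) ^ 2 := by
        rw [← sq_abs]
        exact pow_le_pow_left₀ (abs_nonneg _) h2 2
      simp only [L, LinearMap.coe_mk, AddHom.coe_mk, neg_sq]
      refine h3.trans (le_of_eq ?_)
      rw [mul_pow, mul_pow, Real.sq_sqrt (by positivity), Real.sq_sqrt (by positivity)]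
      ring)
  refine ⟨u.1, ⟨u.2.1, fun g hg h0 h1 => hu ⟨g, hg, h0, h1⟩⟩, fun k => ?_⟩
  fin_cases k
  · exact u.2.2.1
  · exact u.2.2.2

section Laplacian

variable {μ : Measure (K b)}

lemma HasLaplacian.add [IsProbabilityMeasure μ] (hb : 1 ≤ b) {u v u' v' : C(K b, ℝ)} (h : HasLaplacian μ u v)
    (h' : HasLaplacian μ u' v') : HasLaplacian μ (u + u') (v + v') := by
  refine ⟨energy_add_lt_top h.1 h'.1, fun g hg h0 h1 => ?_⟩
  rw [res_add, energyForm_add_left hb h.1 h'.1 hg, h.2 g hg h0 h1, h'.2 g hg h0 h1, ← neg_add]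
  refine congrArg Neg.neg (Eq.trans
    (integral_add (integrable_K hb (v * g)) (integrable_K hb (v' * g))).symm ?_)
  simp [add_mul]

lemma HasLaplacian.smul (hb : 1 ≤ b) (c : ℝ) {u v : C(K b, ℝ)} (h : HasLaplacian μ u v) :
    HasLaplacian μ (c • u) (c • v) := by
  refine ⟨energy_smul_lt_top c h.1, fun g hg h0 h1 => ?_⟩
  rw [res_smul, energyForm_smul_left hb c h.1 hg, h.2 g hg h0 h1, mul_neg, ← integral_const_mul]
  simp [mul_assoc]

lemma HasLaplacian.sub [IsProbabilityMeasure μ] (hb : 1 ≤ b) {u v u' v' : C(K b, ℝ)} (h : HasLaplacian μ u v)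
    (h' : HasLaplacian μ u' v') : HasLaplacian μ (u - u') (v - v') := by
  simpa only [neg_one_smul, ← sub_eq_add_neg] using h.add hb (h'.smul hb (-1))

lemma HasLaplacian.zero [IsProbabilityMeasure μ] (hb : 1 ≤ b) : HasLaplacian μ (0 : C(K b, ℝ)) 0 := by
  obtain ⟨u, hu, -⟩ := exists_hasLaplacian hb μ 0
  simpa using hu.sub hb hu

lemma HasLaplacian.sum [IsProbabilityMeasure μ] (hb : 1 ≤ b) {ι : Type*} (s : Finset ι) {u v : ι → C(K b, ℝ)}
    (h : ∀ i ∈ s, HasLaplacian μ (u i) (v i)) :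
    HasLaplacian μ (∑ i ∈ s, u i) (∑ i ∈ s, v i) := by
  classical
  induction s using Finset.induction_on with
  | empty => simpa using HasLaplacian.zero hb
  | insert a s ha ih =>
    rw [Finset.sum_insert ha, Finset.sum_insert ha]
    exact (h a (by simp)).add hb (ih fun i hi => h i (by simp [hi]))

/-- The difference is an admissible test function for its own equation, so its energy is zero. -/
lemma HasLaplacian.unique [IsProbabilityMeasure μ] (hb : 1 ≤ b) {u u' v : C(K b, ℝ)} (h : HasLaplacian μ u v)
    (h' : HasLaplacian μ u' v) (hq : ∀ k, u (q k) = u' (q k)) : u = u' := by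
  have hd := h.sub hb h'
  rw [sub_self] at hd
  have h0 : ∀ k, (u - u') (q k) = 0 := fun k => by simp [hq k]
  have hE := hd.2 (u - u') hd.1 (h0 0) (h0 1)
  let w : domZero b := ⟨u - u', hd.1, h0 0, h0 1⟩
  have hw : energyZero hb w w = 0 := hE.trans (by simp)
  refine sub_eq_zero.1 (res_injective (funext fun x => ?_))
  have := sq_le_energyZero hb w x
  rw [hw, mul_zero] at this
  exact pow_eq_zero_iff two_ne_zero |>.1 (le_antisymm this (sq_nonneg _))

/-- The harmonic function on `K_b` with given boundary values. -/
lemma exists_harmonic (hb : 1 ≤ b) (μ : Measure (K b)) (α : Fin 2 → ℝ) :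
    ∃ u : C(K b, ℝ), res u = harmonic α ∧ HasLaplacian μ u 0 ∧ ∀ k, u (q k) = α k := by
  obtain ⟨u, hu⟩ := exists_res_eq hb (harmonic_mem hb α)
  refine ⟨u, hu, ⟨?_, fun g hg h0 h1 => ?_⟩, fun k => congrFun hu (.bdry k)⟩
  · exact mem_finEnergy.1 (hu ▸ harmonic_mem hb α)
  · have h0' : res g (.bdry 0) = 0 := h0
    have h1' : res g (.bdry 1) = 0 := h1
    rw [hu, energyForm_harmonic hb α hg, h0', h1']
    simp

/-! ### Multiharmonic functions -/

lemma isMultiharmonic_zero_iff {k : Fin 2} {f : C(K b, ℝ)} : IsMultiharmonic μ 0 k f ↔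
    HasLaplacian μ f 0 ∧ ∀ n, f (q n) = if k = n then 1 else 0 := by
  constructor
  · rintro ⟨u, rfl, h1, h2, h3⟩
    refine ⟨by simpa [← h2] using h1 0 le_rfl, fun n => by simpa using h3 0 le_rfl n⟩
  · rintro ⟨h1, h2⟩
    refine ⟨fun m => if m = 0 then f else 0, rfl, fun m hm => ?_, rfl, fun m hm n => ?_⟩
    · obtain rfl : m = 0 := by omega
      simpa using h1
    · obtain rfl : m = 0 := by omega
      simpa using h2 n

/-- Shifting the chain of iterated Laplacians by one turns the definition into a recursion on `j`, a
Dirichlet problem with zero boundary values at each step. -/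
lemma isMultiharmonic_succ_iff {j : ℕ} {k : Fin 2} {f : C(K b, ℝ)} :
    IsMultiharmonic μ (j + 1) k f ↔
      ∃ g, IsMultiharmonic μ j k g ∧ HasLaplacian μ f g ∧ ∀ n, f (q n) = 0 := by
  constructor
  · rintro ⟨u, rfl, h1, h2, h3⟩
    refine ⟨u 1, ⟨fun m => u (m + 1), rfl, fun m hm => h1 (m + 1) (by omega), h2,
      fun m hm n => ?_⟩, h1 0 (by omega), fun n => by simpa using h3 0 (by omega) n⟩
    simpa using h3 (m + 1) (by omega) n
  · rintro ⟨g, ⟨u, rfl, h1, h2, h3⟩, hf, hq⟩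
    refine ⟨fun m => m.casesOn f u, rfl, fun m hm => ?_, h2, fun m hm n => ?_⟩
    · cases m with
      | zero => exact hf
      | succ m => exact h1 m (by omega)
    · cases m with
      | zero => simpa using hq n
      | succ m => simpa using h3 m (by omega) n

lemma existsUnique_isMultiharmonic [IsProbabilityMeasure μ] (hb : 1 ≤ b) (j : ℕ) (k : Fin 2) :
    ∃! f, IsMultiharmonic μ j k f := by
  induction j with
  | zero =>
    obtain ⟨u, -, hu, hq⟩ := exists_harmonic hb μ fun n => if k = n then 1 else 0
    refine ⟨u, isMultiharmonic_zero_iff.2 ⟨hu, hq⟩, fun v hv => ?_⟩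
    obtain ⟨hv, hq'⟩ := isMultiharmonic_zero_iff.1 hv
    exact hv.unique hb hu fun n => by rw [hq, hq']
  | succ j ih =>
    obtain ⟨g, hg, huniq⟩ := ih
    obtain ⟨u, hu, hq⟩ := exists_hasLaplacian hb μ g
    refine ⟨u, isMultiharmonic_succ_iff.2 ⟨g, hg, hu, hq⟩, fun v hv => ?_⟩
    obtain ⟨g', hg', hv, hq'⟩ := isMultiharmonic_succ_iff.1 hv
    obtain rfl := huniq g' hg'
    exact hv.unique hb hu fun n => by rw [hq, hq']

end Laplacian

/-! ### Scaling of the Laplacian -/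

lemma energyForm_zero_right (f : Vert b → ℝ) : energyForm f 0 = 0 := by
  simp [energyForm]

/-- Distinct copies meet only at images of `q₁`, `q₂`, where `g` vanishes, so `g` can be
transplanted to one copy and extended by zero. These are the test functions that localize the
Laplacian. -/
lemma exists_comp_FKc_eq_ite (hb : 1 ≤ b) (i : Fin (b + 2)) {g : C(K b, ℝ)}
    (hg : InDomEnergy g) (hq : ∀ k, g (q k) = 0) :
    ∃ G : C(K b, ℝ), InDomEnergy G ∧ (∀ k, G (q k) = 0) ∧
      ∀ j, G.comp (FKc j) = if j = i then g else 0 := by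
  let γ : Fin (b + 2) → Vert b → ℝ := fun j => res (if j = i then g else 0)
  have hγ : ∀ j, glue 0 0 γ ∘ F j = γ j := fun j => glue_comp_F j fun k => by
    have h1 : γ j (.bdry k) = 0 := by
      change (if j = i then g else 0) (q k) = 0
      split_ifs
      · exact hq k
      · rfl
    rw [glue_F_bdry, h1]
    simp [cellValue]
  have hmem : glue 0 0 γ ∈ finEnergy b := mem_of_comp_F hb fun j => by
    rw [hγ]
    change res (if j = i then g else 0) ∈ finEnergy b
    split_ifs
    · exact hg
    · exact zero_mem _
  obtain ⟨G, hG⟩ := exists_res_eq hb hmem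
  refine ⟨G, mem_finEnergy.1 (hG ▸ hmem), fun k => congrFun hG (.bdry k), fun j => ?_⟩
  apply res_injective
  rw [res_comp_FKc hb, hG, hγ]

/-- For the transplanted test function only copy `i` contributes: the energy acquires the factor
`r⁻¹` and the integral the factor `(b + 2)⁻¹`. -/
lemma HasLaplacian.comp_FKc (hb : 1 ≤ b) {μ : Measure (K b)} (hμ : IsSelfSimilarMeasure μ)
    {u v : C(K b, ℝ)} (h : HasLaplacian μ u v) (i : Fin (b + 2)) :
    HasLaplacian μ (u.comp (FKc i)) ((renorm b / (b + 2)) • v.comp (FKc i)) := by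
  have hu : res u ∈ finEnergy b := h.1
  refine ⟨by rw [InDomEnergy, res_comp_FKc hb]; exact comp_F_mem hb i hu, fun g hg h0 h1 => ?_⟩
  have hq : ∀ k, g (q k) = 0 := fun k => by fin_cases k; exacts [h0, h1]
  obtain ⟨G, hG, hGq, hGF⟩ := exists_comp_FKc_eq_ite hb i hg hq
  have h2 : energyForm (res u) (res G) = -∫ x, (v * G) x ∂μ := h.2 G hG (hGq 0) (hGq 1)
  rw [energyForm_eq_sum_comp_F hb hu hG, hμ.integral_eq hb (v * G),
    Finset.sum_eq_single i, Finset.sum_eq_single i] at h2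
  · have e : (v * G).comp (FKc i) = v.comp (FKc i) * g := by
      rw [ContinuousMap.mul_comp, hGF, if_pos rfl]
    rw [← res_comp_FKc hb, ← res_comp_FKc hb, hGF, if_pos rfl, e,
      inv_mul_eq_iff_eq_mul₀ (renorm_pos hb).ne'] at h2
    rw [h2]
    simp only [ContinuousMap.mul_apply, ContinuousMap.smul_apply, smul_eq_mul, mul_assoc,
      integral_const_mul]
    ring
  · intro j _ hj
    rw [ContinuousMap.mul_comp, hGF, if_neg hj]
    simp
  · simp
  · intro j _ hj
    rw [← res_comp_FKc hb j G, hGF, if_neg hj]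
    exact energyForm_zero_right _
  · simp

/-! ### The reflection -/

/-- The letters under the reflection exchanging `q₁` and `q₂`. -/
def reflectLetter (b : ℕ) : Equiv.Perm (Fin (b + 2)) :=
  Equiv.swap (Fin.last b).castSucc (Fin.last (b + 1))

/-- The reflection of `V_*` exchanging `q₁` and `q₂`. -/
def reflect : Vert b → Vert b
  | .bdry k => .bdry (1 - k)
  | .inner w k => .inner (w.map (reflectLetter b)) (1 - k)

lemma letter_cases (i : Fin (b + 2)) :
    (i : ℕ) < b ∨ i = (Fin.last b).castSucc ∨ i = Fin.last (b + 1) := by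
  rcases lt_trichotomy (i : ℕ) b with h | h | h
  · exact Or.inl h
  · exact Or.inr (Or.inl (Fin.ext h))
  · exact Or.inr (Or.inr (Fin.ext (by simp; omega)))

lemma reflectLetter_of_lt {i : Fin (b + 2)} (h : (i : ℕ) < b) : reflectLetter b i = i :=
  Equiv.swap_apply_of_ne_of_ne (fun e => by simp [e] at h) (fun e => by simp [e] at h)

lemma reflect_F (i : Fin (b + 2)) (x : Vert b) :
    reflect (F i x) = F (reflectLetter b i) (reflect x) := by
  cases x with
  | inner w k => rfl
  | bdry k =>
    rcases letter_cases i with h | rfl | rfl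
    · rw [reflectLetter_of_lt h]
      simp [F, reflect, h]
    · rw [reflectLetter, Equiv.swap_apply_left]
      fin_cases k <;> simp [F, reflect]
    · rw [reflectLetter, Equiv.swap_apply_right]
      fin_cases k <;> simp [F, reflect]

lemma reflect_reflect (x : Vert b) : reflect (reflect x) = x := by
  have h : ∀ i, reflectLetter b (reflectLetter b i) = i := fun i => Equiv.swap_apply_self _ _ i
  cases x with
  | bdry k => simp [reflect]
  | inner w k => simp [reflect, Function.comp_def, h]

lemma levelEnergy_comp_reflect (ℓ : ℕ) (f : Vert b → ℝ) :
    levelEnergy ℓ (f ∘ reflect) = levelEnergy ℓ f := by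
  induction ℓ generalizing f with
  | zero =>
    rw [levelEnergy_zero, levelEnergy_zero]
    simp only [Function.comp, reflect, sub_zero, sub_self]
    ring
  | succ ℓ ih =>
    rw [levelEnergy_succ, levelEnergy_succ,
      ← Equiv.sum_comp (reflectLetter b) fun i => levelEnergy ℓ (f ∘ F i)]
    congr 1
    refine Finset.sum_congr rfl fun i _ => ?_
    rw [← ih (f ∘ F (reflectLetter b i))]
    congr 1
    funext x
    exact congrArg f (reflect_F i x)

lemma energy_comp_reflect (f : Vert b → ℝ) : energy (f ∘ reflect) = energy f := by
  simp only [energy, levelEnergy_comp_reflect]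

lemma energyForm_comp_reflect (f g : Vert b → ℝ) :
    energyForm (f ∘ reflect) (g ∘ reflect) = energyForm f g := by
  unfold energyForm
  rw [← energy_comp_reflect (f + g), ← energy_comp_reflect (f - g)]
  rfl

lemma uniformContinuous_reflect : UniformContinuous (reflect : Vert b → Vert b) := by
  have : LipschitzWith 1 (reflect : Vert b → Vert b) := fun x y => by
    rw [ENNReal.coe_one, one_mul]
    refine sInf_le_sInf fun A hA f hf => ?_
    rw [← energy_comp_reflect f] at hf ⊢
    exact hA _ hf
  exact this.uniformContinuous

/-- The reflection of `K_b` exchanging `q₁` and `q₂`. -/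
noncomputable def reflectK (b : ℕ) : C(K b, K b) :=
  ⟨UniformSpace.Completion.map reflect, UniformSpace.Completion.continuous_map⟩

lemma reflectK_coe (x : Vert b) : reflectK b (x : K b) = (reflect x : Vert b) :=
  UniformSpace.Completion.map_coe uniformContinuous_reflect x

lemma reflectK_reflectK : (reflectK b).comp (reflectK b) = ContinuousMap.id _ :=
  ContinuousMap.ext fun x => UniformSpace.Completion.induction_on x
    (isClosed_eq (map_continuous _) (map_continuous _)) fun x => by
      simp [reflectK_coe, reflect_reflect]

lemma reflectK_FKc (hb : 1 ≤ b) (i : Fin (b + 2)) :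
    (reflectK b).comp (FKc i) = (FKc (reflectLetter b i)).comp (reflectK b) :=
  ContinuousMap.ext fun x => UniformSpace.Completion.induction_on x
    (isClosed_eq (map_continuous _) (map_continuous _)) fun x => by
      simp [reflectK_coe, FKc_coe hb, reflect_F]

lemma reflectK_q (k : Fin 2) : reflectK b (q k) = q (1 - k) := reflectK_coe _

lemma res_comp_reflectK (u : C(K b, ℝ)) : res (u.comp (reflectK b)) = res u ∘ reflect := by
  funext x
  exact congrArg u (reflectK_coe x)

lemma comp_reflectK_comp_reflectK (u : C(K b, ℝ)) :
    (u.comp (reflectK b)).comp (reflectK b) = u := by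
  rw [ContinuousMap.comp_assoc, reflectK_reflectK, ContinuousMap.comp_id]

/-- The reflection permutes the copies, so the image measure is again self-similar and uniqueness
applies. -/
lemma IsSelfSimilarMeasure.map_reflectK (hb : 1 ≤ b) {μ : Measure (K b)}
    (hμ : IsSelfSimilarMeasure μ) : μ.map (reflectK b) = μ := by
  have hm : Measurable (reflectK b) := (map_continuous _).measurable
  refine IsSelfSimilarMeasure.unique hb ⟨?_, fun A hA => ?_⟩ hμ
  · rw [Measure.map_apply hm MeasurableSet.univ, Set.preimage_univ, hμ.1]
  · rw [Measure.map_apply hm hA, hμ.2 _ (hm hA), 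
      ← Equiv.sum_comp (reflectLetter b) fun i => μ.map (reflectK b) (FK i ⁻¹' A)]
    congr 1
    refine Finset.sum_congr rfl fun i _ => ?_
    rw [Measure.map_apply hm (measurable_FK _ hA), ← Set.preimage_comp, ← Set.preimage_comp]
    congr 2
    exact congrArg DFunLike.coe (reflectK_FKc hb i)

lemma IsSelfSimilarMeasure.integral_comp_reflectK (hb : 1 ≤ b) {μ : Measure (K b)}
    (hμ : IsSelfSimilarMeasure μ) (φ : C(K b, ℝ)) :
    ∫ x, φ.comp (reflectK b) x ∂μ = ∫ x, φ x ∂μ := by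
  have := metrizableSpace_K hb
  have := compactSpace_K hb
  conv_rhs => rw [← hμ.map_reflectK hb]
  rw [integral_map (map_continuous _).measurable.aemeasurable φ.continuous.aestronglyMeasurable]
  rfl

lemma HasLaplacian.comp_reflectK (hb : 1 ≤ b) {μ : Measure (K b)} (hμ : IsSelfSimilarMeasure μ)
    {u v : C(K b, ℝ)} (h : HasLaplacian μ u v) :
    HasLaplacian μ (u.comp (reflectK b)) (v.comp (reflectK b)) := by
  have hdom : ∀ {w : C(K b, ℝ)}, InDomEnergy w → InDomEnergy (w.comp (reflectK b)) := by
    intro w hw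
    rwa [InDomEnergy, res_comp_reflectK, energy_comp_reflect]
  refine ⟨hdom h.1, fun g hg h0 h1 => ?_⟩
  have h2 := h.2 (g.comp (reflectK b)) (hdom hg) (by simpa [reflectK_q] using h1)
    (by simpa [reflectK_q] using h0)
  rw [← energyForm_comp_reflect, ← res_comp_reflectK, ← res_comp_reflectK,
    comp_reflectK_comp_reflectK] at h2
  rw [h2]
  have h3 := hμ.integral_comp_reflectK hb (v * g.comp (reflectK b))
  rw [ContinuousMap.mul_comp, comp_reflectK_comp_reflectK] at h3
  exact congrArg Neg.neg h3.symm

lemma IsMultiharmonic.comp_reflectK (hb : 1 ≤ b) {μ : Measure (K b)}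
    (hμ : IsSelfSimilarMeasure μ) {j : ℕ} {k : Fin 2} {f : C(K b, ℝ)}
    (h : IsMultiharmonic μ j k f) : IsMultiharmonic μ j (1 - k) (f.comp (reflectK b)) := by
  induction j generalizing f with
  | zero =>
    obtain ⟨h1, h2⟩ := isMultiharmonic_zero_iff.1 h
    refine isMultiharmonic_zero_iff.2 ⟨h1.comp_reflectK hb hμ, fun n => ?_⟩
    rw [ContinuousMap.comp_apply, reflectK_q, h2]
    congr 1
    fin_cases k <;> fin_cases n <;> simp
  | succ j ih =>
    obtain ⟨g, hg, h1, h2⟩ := isMultiharmonic_succ_iff.1 h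
    refine isMultiharmonic_succ_iff.2 ⟨_, ih hg, h1.comp_reflectK hb hμ, fun n => ?_⟩
    rw [ContinuousMap.comp_apply, reflectK_q, h2]

/-! ### Families of multiharmonic functions -/

section Family

variable {μ : Measure (K b)} {f : ℕ → Fin 2 → C(K b, ℝ)}

lemma hasLaplacian_zero (hf : ∀ j k, IsMultiharmonic μ j k (f j k)) (k : Fin 2) :
    HasLaplacian μ (f 0 k) 0 := (isMultiharmonic_zero_iff.1 (hf 0 k)).1

lemma hasLaplacian_succ [IsProbabilityMeasure μ] (hb : 1 ≤ b)
    (hf : ∀ j k, IsMultiharmonic μ j k (f j k)) (j : ℕ) (k : Fin 2) :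
    HasLaplacian μ (f (j + 1) k) (f j k) := by
  obtain ⟨g, hg, h, -⟩ := isMultiharmonic_succ_iff.1 (hf (j + 1) k)
  exact (existsUnique_isMultiharmonic hb j k).unique hg (hf j k) ▸ h

lemma apply_zero_q (hf : ∀ j k, IsMultiharmonic μ j k (f j k)) (k n : Fin 2) :
    f 0 k (q n) = if k = n then 1 else 0 := (isMultiharmonic_zero_iff.1 (hf 0 k)).2 n

lemma apply_succ_q (hf : ∀ j k, IsMultiharmonic μ j k (f j k)) (j : ℕ) (k n : Fin 2) :
    f (j + 1) k (q n) = 0 := by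
  obtain ⟨-, -, -, h⟩ := isMultiharmonic_succ_iff.1 (hf (j + 1) k)
  exact h n

lemma comp_reflectK_eq (hb : 1 ≤ b) (hμ : IsSelfSimilarMeasure μ)
    (hf : ∀ j k, IsMultiharmonic μ j k (f j k)) (j : ℕ) (k : Fin 2) :
    (f j k).comp (reflectK b) = f j (1 - k) := by
  have := hμ.isProbabilityMeasure
  exact (existsUnique_isMultiharmonic hb j (1 - k)).unique ((hf j k).comp_reflectK hb hμ)
    (hf j (1 - k))

/-- The restriction of a multiharmonic function to a copy. -/
lemma comp_FKc_eq (hb : 1 ≤ b) (hμ : IsSelfSimilarMeasure μ)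
    (hf : ∀ j k, IsMultiharmonic μ j k (f j k)) (i : Fin (b + 2)) (j : ℕ) (k : Fin 2) :
    (f j k).comp (FKc i) = ∑ l ∈ Finset.range (j + 1),
      (renorm b / (b + 2)) ^ l • ∑ n, f (j - l) k (FK i (q n)) • f l n := by
  have := hμ.isProbabilityMeasure
  have hzero : ∀ c : Fin 2 → ℝ, HasLaplacian μ (∑ n, c n • f 0 n) 0 := fun c => by
    simpa using HasLaplacian.sum hb Finset.univ fun n _ => (hasLaplacian_zero hf n).smul hb (c n)
  have hbdry : ∀ (c : Fin 2 → ℝ) s, (∑ n, c n • f 0 n) (q s) = c s := fun c s => by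
    fin_cases s <;> simp [apply_zero_q hf]
  have hpt : ∀ (u : C(K b, ℝ)) s, u.comp (FKc i) (q s) = u (FK i (q s)) := fun _ _ => rfl
  induction j with
  | zero =>
    have h := (hasLaplacian_zero hf k).comp_FKc hb hμ i
    rw [show (0 : C(K b, ℝ)).comp (FKc i) = 0 from rfl, smul_zero] at h
    rw [zero_add, Finset.sum_range_one, pow_zero, one_smul]
    refine h.unique hb (hzero _) fun s => ?_
    rw [hbdry, hpt]
  | succ j ih =>
    have h := (hasLaplacian_succ hb hf j k).comp_FKc hb hμ i
    -- The terms with positive index have the required Laplacian and vanish on the boundary; the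
    -- term of index `0` is harmonic and supplies the boundary values.
    have h0 : HasLaplacian μ (∑ l ∈ Finset.range (j + 1), (renorm b / (b + 2)) ^ (l + 1) •
        ∑ n, f (j + 1 - (l + 1)) k (FK i (q n)) • f (l + 1) n)
        ((renorm b / (b + 2)) • (f j k).comp (FKc i)) := by
      rw [ih, Finset.smul_sum]
      refine HasLaplacian.sum hb _ fun l _ => ?_
      rw [smul_smul, ← pow_succ', Nat.add_sub_add_right]
      refine HasLaplacian.smul hb _ (HasLaplacian.sum hb _ fun n _ => ?_)
      exact (hasLaplacian_succ hb hf l n).smul hb _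
    rw [Finset.sum_range_succ', pow_zero, one_smul]
    have h1 := h0.add hb (hzero fun n => f (j + 1) k (FK i (q n)))
    rw [add_zero] at h1
    refine h.unique hb h1 fun s => ?_
    rw [ContinuousMap.add_apply, hbdry, hpt]
    simp [apply_succ_q hf]

/-! ### Testing against piecewise harmonic functions -/

/-- The piecewise harmonic function of level one with values `β` on the inner vertices of `G_1`
and zero boundary values. -/
lemma exists_piecewiseHarmonic (hb : 1 ≤ b) [IsProbabilityMeasure μ]
    (hf : ∀ j k, IsMultiharmonic μ j k (f j k)) (β : Fin 2 → ℝ) :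
    ∃ ψ : C(K b, ℝ), InDomEnergy ψ ∧ (∀ k, ψ (q k) = 0) ∧
      ∀ i, res ψ ∘ F i = harmonic (cellValue 0 β i) ∧
        ψ.comp (FKc i) = ∑ n, cellValue 0 β i n • f 0 n := by
  let γ : Fin (b + 2) → Vert b → ℝ := fun i => harmonic (cellValue 0 β i)
  have hγ : ∀ i, glue 0 β γ ∘ F i = γ i := fun i => glue_comp_F i fun k =>
    (glue_F_bdry 0 β γ i k).symm
  have hmem : glue 0 β γ ∈ finEnergy b := mem_of_comp_F hb fun i => by
    rw [hγ]
    exact harmonic_mem hb _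
  obtain ⟨ψ, hψ⟩ := exists_res_eq hb hmem
  refine ⟨ψ, mem_finEnergy.1 (hψ ▸ hmem), fun k => congrFun hψ (.bdry k), fun i => ?_⟩
  have h1 : res ψ ∘ F i = harmonic (cellValue 0 β i) := by rw [hψ, hγ]
  refine ⟨h1, ?_⟩
  obtain ⟨u, hu, hΔ, hq⟩ := exists_harmonic hb μ (cellValue 0 β i)
  have e : ψ.comp (FKc i) = u := res_injective (by rw [res_comp_FKc hb, h1, hu])
  have hs : HasLaplacian μ (∑ n, cellValue 0 β i n • f 0 n) 0 := by
    simpa using HasLaplacian.sum hb Finset.univ fun n _ =>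
      (hasLaplacian_zero hf n).smul hb (cellValue 0 β i n)
  rw [e]
  refine hΔ.unique hb hs fun s => ?_
  rw [hq]
  fin_cases s <;> simp [apply_zero_q hf]

/-- The equation `Δ u = v` tested against a piecewise harmonic function of level one. -/
lemma HasLaplacian.level_one (hb : 1 ≤ b) (hμ : IsSelfSimilarMeasure μ)
    (hf : ∀ j k, IsMultiharmonic μ j k (f j k)) {u v : C(K b, ℝ)} (h : HasLaplacian μ u v)
    (β : Fin 2 → ℝ) :
    (renorm b)⁻¹ * (b * ((β 0 - β 1) * (res u (.inner [] 0) - res u (.inner [] 1)))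
        - β 0 * (u (q 0) - res u (.inner [] 0)) + β 1 * (res u (.inner [] 1) - u (q 1)))
      = -((b + 2 : ℝ)⁻¹ * ∑ i, ∑ n, cellValue 0 β i n *
          ∫ x, v.comp (FKc i) x * f 0 n x ∂μ) := by
  have := hμ.isProbabilityMeasure
  obtain ⟨ψ, hψ, hq, hi⟩ := exists_piecewiseHarmonic hb hf β
  have h2 : energyForm (res u) (res ψ) = -∫ x, (v * ψ) x ∂μ := h.2 ψ hψ (hq 0) (hq 1)
  have hu : res u ∈ finEnergy b := h.1
  -- On each copy the harmonic function must occupy the first slot for `energyForm_harmonic` to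
  -- apply.
  rw [energyForm_comm hb hu hψ, energyForm_eq_sum_comp_F hb hψ hu, hμ.integral_eq hb (v * ψ)] at h2
  simp only [ContinuousMap.mul_comp, (hi _).1, (hi _).2,
    energyForm_harmonic hb _ (comp_F_mem hb _ hu), Function.comp] at h2
  rw [sum_cellValue] at h2
  have h3 : ∀ i, ∫ x, (v.comp (FKc i) * ∑ n, cellValue 0 β i n • f 0 n) x ∂μ
      = ∑ n, cellValue 0 β i n * ∫ x, v.comp (FKc i) x * f 0 n x ∂μ := fun i => by
    have := map_sum (integralMean hb μ)
      (fun n => cellValue 0 β i n • (v.comp (FKc i) * f 0 n)) Finset.univ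
    simp only [map_smul, smul_eq_mul] at this
    simp only [Finset.mul_sum, mul_smul_comm]
    exact this
  simp only [h3] at h2
  rw [← h2]
  simp only [Pi.zero_apply, zero_sub, sub_zero, neg_mul]
  rfl

/-! ### The recursion -/

lemma integral_comp_FKc_mul (hb : 1 ≤ b) (hμ : IsSelfSimilarMeasure μ)
    (hf : ∀ j k, IsMultiharmonic μ j k (f j k)) (i : Fin (b + 2)) (j : ℕ) (k : Fin 2)
    (g : C(K b, ℝ)) :
    ∫ x, (f j k).comp (FKc i) x * g x ∂μ = ∑ l ∈ Finset.range (j + 1),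
      (renorm b / (b + 2)) ^ l * ∑ n, f (j - l) k (FK i (q n)) * ∫ x, f l n x * g x ∂μ := by
  have := hμ.isProbabilityMeasure
  have h : integralMean hb μ ((f j k).comp (FKc i) * g) = ∑ l ∈ Finset.range (j + 1),
      (renorm b / (b + 2)) ^ l * ∑ n, f (j - l) k (FK i (q n)) *
        integralMean hb μ (f l n * g) := by
    rw [comp_FKc_eq hb hμ hf]
    simp only [Finset.sum_mul, smul_mul_assoc, map_sum, map_smul, smul_eq_mul]
  exact h

lemma FK_q (hb : 1 ≤ b) (i : Fin (b + 2)) (k : Fin 2) :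
    FK i (q k) = ((F i (.bdry k) : Vert b) : K b) := FKc_coe hb i (.bdry k)

lemma integral_comp_reflectK_mul (hb : 1 ≤ b) (hμ : IsSelfSimilarMeasure μ)
    (hf : ∀ j k, IsMultiharmonic μ j k (f j k)) (l : ℕ) (k n : Fin 2) :
    ∫ x, f l (1 - k) x * f 0 (1 - n) x ∂μ = ∫ x, f l k x * f 0 n x ∂μ := by
  rw [← comp_reflectK_eq hb hμ hf, ← comp_reflectK_eq hb hμ hf]
  exact hμ.integral_comp_reflectK hb (f l k * f 0 n)

lemma res_inner_reflect (hb : 1 ≤ b) (hμ : IsSelfSimilarMeasure μ)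
    (hf : ∀ j k, IsMultiharmonic μ j k (f j k)) (l : ℕ) (k n : Fin 2) :
    res (f l (1 - k)) (.inner [] (1 - n)) = res (f l k) (.inner [] n) := by
  rw [← comp_reflectK_eq hb hμ hf, res_comp_reflectK]
  fin_cases n <;> rfl

lemma sum_letters_of_forall {g : Fin (b + 2) → ℝ} {c : ℝ}
    (h : ∀ i : Fin (b + 2), (i : ℕ) < b → g i = c) :
    ∑ i, g i = b * c + g (Fin.last b).castSucc + g (Fin.last (b + 1)) := by
  rw [sum_letters, Finset.sum_congr rfl fun i _ => h i.castSucc.castSucc (by simp)]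
  simp

/-- The two linear equations for the values of `f_{j0}` on the inner vertices of `G_1`. -/
lemma recursion (hb : 1 ≤ b) (hμ : IsSelfSimilarMeasure μ)
    (hf : ∀ j k, IsMultiharmonic μ j k (f j k)) {a β p q : ℕ → ℝ}
    (ha : ∀ l, a l = ∫ x, f l 0 x * f 0 0 x ∂μ) (hβ : ∀ l, β l = ∫ x, f l 0 x * f 0 1 x ∂μ)
    (hp : ∀ l, (renorm b / (b + 2)) ^ l * p l = res (f l 0) (.inner [] 0))
    (hq : ∀ l, (renorm b / (b + 2)) ^ l * q l = res (f l 0) (.inner [] 1)) (j : ℕ) :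
    (b + 1) * p (j + 1) - b * q (j + 1)
        = -((b + 1) * ∑ l ∈ Finset.range (j + 1), p (j - l) * a l
          + b * ∑ l ∈ Finset.range (j + 1), q (j - l) * β l) - β j ∧
      (b + 1) * q (j + 1) - b * p (j + 1)
        = -((b + 1) * ∑ l ∈ Finset.range (j + 1), q (j - l) * a l
          + b * ∑ l ∈ Finset.range (j + 1), p (j - l) * β l) := by
  have := hμ.isProbabilityMeasure
  set c : ℝ := renorm b / (b + 2) with hc
  have hc0 : 0 < c := by have := renorm_pos hb; positivity
  have hΔ := hasLaplacian_succ hb hf j 0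
  have ha' : ∀ l, ∫ x, f l 1 x * f 0 1 x ∂μ = a l := fun l =>
    (integral_comp_reflectK_mul hb hμ hf l 0 0).trans (ha l).symm
  have hβ' : ∀ l, ∫ x, f l 1 x * f 0 0 x ∂μ = β l := fun l =>
    (integral_comp_reflectK_mul hb hμ hf l 0 1).trans (hβ l).symm
  have hmid : ∀ i : Fin (b + 2), (i : ℕ) < b → ∀ l,
      f l 0 (FK i (BubbleDiamond.q 0)) = c ^ l * p l ∧
      f l 0 (FK i (BubbleDiamond.q 1)) = c ^ l * q l := fun i hi l => by
    rw [FK_q hb, FK_q hb, hp, hq]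
    simp [F, hi, res]
  have hleft : ∀ l, f l 0 (FK (Fin.last b).castSucc (BubbleDiamond.q 0))
        = f l 0 (BubbleDiamond.q 0) ∧
      f l 0 (FK (Fin.last b).castSucc (BubbleDiamond.q 1)) = c ^ l * p l := fun l => by
    rw [FK_q hb, FK_q hb, hp]
    simp [F, res, BubbleDiamond.q]
  have hright : ∀ l, f l 0 (FK (Fin.last (b + 1)) (BubbleDiamond.q 0)) = c ^ l * q l ∧
      f l 0 (FK (Fin.last (b + 1)) (BubbleDiamond.q 1)) = 0 := fun l => by
    rw [FK_q hb, FK_q hb, hq]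
    refine ⟨by simp [F, res], ?_⟩
    have : f l 0 (BubbleDiamond.q 1) = 0 := by
      cases l with
      | zero => simp [apply_zero_q hf]
      | succ l => exact apply_succ_q hf l 0 1
    simpa [F, BubbleDiamond.q] using this
  have hpow : ∀ {l : ℕ}, l ∈ Finset.range (j + 1) → ∀ x y : ℝ,
      c ^ l * (c ^ (j - l) * x * y) = c ^ j * (x * y) := fun {l} hl x y => by
    rw [← Nat.add_sub_of_le (Nat.lt_succ_iff.1 (Finset.mem_range.1 hl)), pow_add]
    simp only [Nat.add_sub_cancel_left]
    ring
  have hI : ∀ i n, ∫ x, (f j 0).comp (FKc i) x * f 0 n x ∂μ = ∑ l ∈ Finset.range (j + 1),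
      c ^ l * ∑ s, f (j - l) 0 (FK i (BubbleDiamond.q s)) * ∫ x, f l s x * f 0 n x ∂μ :=
    fun i n => integral_comp_FKc_mul hb hμ hf i j 0 (f 0 n)
  have hmid0 : ∀ i : Fin (b + 2), (i : ℕ) < b → ∫ x, (f j 0).comp (FKc i) x * f 0 0 x ∂μ
      = c ^ j * (∑ l ∈ Finset.range (j + 1), p (j - l) * a l
        + ∑ l ∈ Finset.range (j + 1), q (j - l) * β l) := fun i hi => by
    rw [hI, ← Finset.sum_add_distrib, Finset.mul_sum]
    refine Finset.sum_congr rfl fun l hl => ?_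
    rw [Fin.sum_univ_two, (hmid i hi _).1, (hmid i hi _).2, ← ha, hβ', mul_add, hpow hl, hpow hl,
      mul_add]
  have hmid1 : ∀ i : Fin (b + 2), (i : ℕ) < b → ∫ x, (f j 0).comp (FKc i) x * f 0 1 x ∂μ
      = c ^ j * (∑ l ∈ Finset.range (j + 1), p (j - l) * β l
        + ∑ l ∈ Finset.range (j + 1), q (j - l) * a l) := fun i hi => by
    rw [hI, ← Finset.sum_add_distrib, Finset.mul_sum]
    refine Finset.sum_congr rfl fun l hl => ?_
    rw [Fin.sum_univ_two, (hmid i hi _).1, (hmid i hi _).2, ← hβ, ha', mul_add, hpow hl, hpow hl,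
      mul_add]
  have hleft1 : ∫ x, (f j 0).comp (FKc (Fin.last b).castSucc) x * f 0 1 x ∂μ
      = c ^ j * (β j + ∑ l ∈ Finset.range (j + 1), p (j - l) * a l) := by
    rw [hI, mul_add, Finset.mul_sum]
    simp only [Fin.sum_univ_two, (hleft _).1, (hleft _).2, mul_add, Finset.sum_add_distrib,
      ← hβ, ha']
    congr 1
    -- The coefficients are the values `f_{j-l}(q₁)`, which vanish unless `l = j`. The surviving
    -- term is the isolated `b_{j-1}` of the theorem.
    · rw [Finset.sum_range_succ, Finset.sum_eq_zero fun l hl => ?_]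
      · simp [apply_zero_q hf]
      · obtain ⟨m, hm⟩ := Nat.exists_eq_add_of_lt (Finset.mem_range.1 hl)
        rw [show j - l = m + 1 by omega, apply_succ_q hf]
        simp
    · exact Finset.sum_congr rfl fun l hl => hpow hl _ _
  have hright0 : ∫ x, (f j 0).comp (FKc (Fin.last (b + 1))) x * f 0 0 x ∂μ
      = c ^ j * ∑ l ∈ Finset.range (j + 1), q (j - l) * a l := by
    rw [hI, Finset.mul_sum]
    refine Finset.sum_congr rfl fun l hl => ?_
    rw [Fin.sum_univ_two, (hright _).1, (hright _).2, ← ha, zero_mul, add_zero, hpow hl]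
  -- Since `r⁻¹ c = (b + 2)⁻¹`, all powers of `c` cancel; this is why `p` and `q` are normalized by
  -- `c ^ ℓ`.
  have hscale : ∀ {X Y : ℝ},
      (renorm b)⁻¹ * (c ^ (j + 1) * X) = -((b + 2 : ℝ)⁻¹ * (c ^ j * Y)) → X = -Y := by
    intro X Y h
    have hr := (renorm_pos hb).ne'
    have e : c * (renorm b)⁻¹ = (b + 2 : ℝ)⁻¹ := by rw [hc]; field_simp
    have h' : (c ^ j * (b + 2 : ℝ)⁻¹) * X = (c ^ j * (b + 2 : ℝ)⁻¹) * (-Y) := by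
      rw [pow_succ] at h
      linear_combination h - c ^ j * X * e
    exact mul_left_cancel₀ (by positivity) h'
  -- The test functions concentrated at `p₁` and `p₂` give one equation each.
  have h0 := hΔ.level_one hb hμ hf ![1, 0]
  have h1 := hΔ.level_one hb hμ hf ![0, 1]
  rw [← hp, ← hq, apply_succ_q hf, apply_succ_q hf, sum_letters_of_forall (c := c ^ j *
    (∑ l ∈ Finset.range (j + 1), p (j - l) * a l + ∑ l ∈ Finset.range (j + 1), q (j - l) * β l))
    fun i hi => by simp [cellValue, hi, hmid0 i hi,
      -ContinuousMap.comp_apply, -ContinuousMap.coe_comp]] at h0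
  rw [← hp, ← hq, apply_succ_q hf, apply_succ_q hf, sum_letters_of_forall (c := c ^ j *
    (∑ l ∈ Finset.range (j + 1), p (j - l) * β l + ∑ l ∈ Finset.range (j + 1), q (j - l) * a l))
    fun i hi => by simp [cellValue, hi, hmid1 i hi,
      -ContinuousMap.comp_apply, -ContinuousMap.coe_comp]] at h1
  simp [cellValue, hleft1,
      -ContinuousMap.comp_apply, -ContinuousMap.coe_comp] at h0
  simp [cellValue, hright0,
      -ContinuousMap.comp_apply, -ContinuousMap.coe_comp] at h1
  generalize ∑ l ∈ Finset.range (j + 1), p (j - l) * a l = S1 at *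
  generalize ∑ l ∈ Finset.range (j + 1), q (j - l) * a l = S2 at *
  generalize ∑ l ∈ Finset.range (j + 1), p (j - l) * β l = S3 at *
  generalize ∑ l ∈ Finset.range (j + 1), q (j - l) * β l = S4 at *
  have h0' := hscale (X := (b + 1) * p (j + 1) - b * q (j + 1))
    (Y := b * (S1 + S4) + (β j + S1)) (by linear_combination h0)
  have h1' := hscale (X := (b + 1) * q (j + 1) - b * p (j + 1))
    (Y := b * (S3 + S2) + S2) (by linear_combination h1)
  exact ⟨by linear_combination h0', by linear_combination h1'⟩

/-! ### The initial values -/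

lemma res_zero_inner (hb : 1 ≤ b) (hμ : IsSelfSimilarMeasure μ)
    (hf : ∀ j k, IsMultiharmonic μ j k (f j k)) :
    res (f 0 0) (.inner [] 0) = (b + 1) / (2 * b + 1) ∧
      res (f 0 0) (.inner [] 1) = b / (2 * b + 1) := by
  have hr := (renorm_pos hb).ne'
  have h : ∀ β, _ := (hasLaplacian_zero hf 0).level_one hb hμ hf
  have h0 := h ![1, 0]
  have h1 := h ![0, 1]
  simp [hr, apply_zero_q hf] at h0 h1
  have hb1 : (2 * b + 1 : ℝ) ≠ 0 := by positivity
  constructor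
  · rw [eq_div_iff hb1]
    linear_combination (b + 1) * h0 + b * h1
  · rw [eq_div_iff hb1]
    linear_combination b * h0 + (b + 1) * h1

lemma hasLaplacian_one (hb : 1 ≤ b) (μ : Measure (K b)) : HasLaplacian μ 1 0 := by
  have h1 : res (1 : C(K b, ℝ)) ∈ finEnergy b := energy_lt_top_of_bound (C := 0) fun ℓ => by
    simp [levelEnergy, res]
  refine ⟨h1, fun g hg _ _ => ?_⟩
  refine tendsto_nhds_unique (tendsto_levelForm hb h1 hg) ?_
  simp [levelForm_eq_sum, res]

/-- Two linear equations determine the integrals: `2A + 2B = 1`, from squaring `f₀₁ + f₀₂ = 1`, and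
the self-similar decomposition of `∫ f₀₁²`, whose pieces are quadratic forms in the corner values.
-/
lemma integral_zero_zero (hb : 1 ≤ b) (hμ : IsSelfSimilarMeasure μ)
    (hf : ∀ j k, IsMultiharmonic μ j k (f j k)) :
    ∫ x, f 0 0 x * f 0 0 x ∂μ = (b + 1) / (2 + 4 * b) ∧
      ∫ x, f 0 0 x * f 0 1 x ∂μ = b / (2 + 4 * b) := by
  have := hμ.isProbabilityMeasure
  have hone : f 0 0 + f 0 1 = 1 := by
    have h := (hasLaplacian_zero hf 0).add hb (hasLaplacian_zero hf 1)
    rw [add_zero] at h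
    refine h.unique hb (hasLaplacian_one hb μ) fun s => ?_
    fin_cases s <;> simp [apply_zero_q hf]
  have hrefl : ∀ k n, ∫ x, f 0 (1 - k) x * f 0 (1 - n) x ∂μ = ∫ x, f 0 k x * f 0 n x ∂μ :=
    integral_comp_reflectK_mul hb hμ hf 0
  set A := ∫ x, f 0 0 x * f 0 0 x ∂μ with hA
  set B := ∫ x, f 0 0 x * f 0 1 x ∂μ with hB
  have hA1 : ∫ x, f 0 1 x * f 0 1 x ∂μ = A := hrefl 0 0
  have hB1 : ∫ x, f 0 1 x * f 0 0 x ∂μ = B := hrefl 0 1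
  have hquad : ∀ s t : ℝ, ∫ x, ((s • f 0 0 + t • f 0 1) * (s • f 0 0 + t • f 0 1)) x ∂μ
      = s ^ 2 * A + 2 * s * t * B + t ^ 2 * A := fun s t => by
    have e : (s • f 0 0 + t • f 0 1) * (s • f 0 0 + t • f 0 1) = s ^ 2 • (f 0 0 * f 0 0)
        + (s * t) • (f 0 0 * f 0 1) + (s * t) • (f 0 1 * f 0 0) + t ^ 2 • (f 0 1 * f 0 1) := by
      ext x
      simp
      ring
    have h : integralMean hb μ ((s • f 0 0 + t • f 0 1) * (s • f 0 0 + t • f 0 1))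
        = s ^ 2 * A + (s * t) * B + (s * t) * B + t ^ 2 * A := by
      rw [e]
      simp only [map_add, map_smul, smul_eq_mul]
      congr 1
      · congr 1
        exact congrArg _ hB1
      · exact congrArg _ hA1
    exact h.trans (by ring)
  have hsum : 2 * A + 2 * B = 1 := by
    have h := hquad 1 1
    rw [one_smul, one_smul, hone, mul_one] at h
    simp at h
    linarith
  obtain ⟨hp, hq⟩ := res_zero_inner hb hμ hf
  have hexp : ∀ i, (f 0 0).comp (FKc i)
      = f 0 0 (FK i (q 0)) • f 0 0 + f 0 0 (FK i (q 1)) • f 0 1 := fun i => by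
    rw [comp_FKc_eq hb hμ hf, zero_add, Finset.sum_range_one, pow_zero, one_smul, Fin.sum_univ_two]
  have hself := hμ.integral_eq hb (f 0 0 * f 0 0)
  simp only [ContinuousMap.mul_comp, hexp, hquad] at hself
  set P : ℝ := (b + 1) / (2 * b + 1) with hP
  set Q : ℝ := b / (2 * b + 1) with hQ
  have hv0 : res (f 0 0) (.bdry 0) = 1 := (apply_zero_q hf 0 0).trans (by simp)
  have hv1 : res (f 0 0) (.bdry 1) = 0 := (apply_zero_q hf 0 1).trans (by simp)
  have hval : ∀ i k, f 0 0 (FK i (q k)) = res (f 0 0) (F i (.bdry k)) := fun i k => by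
    rw [FK_q hb]; rfl
  simp only [hval] at hself
  rw [sum_letters_of_forall (c := P ^ 2 * A + 2 * P * Q * B + Q ^ 2 * A) fun i hi => by
    simp [F, hi, hp, hq]] at hself
  simp only [F] at hself
  simp [hp, hq, hv0, hv1] at hself
  have hb0 : (0 : ℝ) < 2 * b + 1 := by positivity
  have hself' : (b + 2 : ℝ) * A = b * (P ^ 2 * A + 2 * P * Q * B + Q ^ 2 * A)
      + (A + 2 * P * B + P ^ 2 * A) + Q ^ 2 * A := by
    change A = _ at hself
    rw [eq_inv_mul_iff_mul_eq₀ (by positivity)] at hself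
    exact hself
  have hB' : B = 1 / 2 - A := by linarith
  rw [hB', hP, hQ] at hself'
  field_simp at hself'
  have hval : A = (b + 1) / (2 + 4 * b) := by
    rw [eq_div_iff (by positivity)]
    -- With `B` eliminated and denominators cleared, the equation is `2 (2b+1) (b+1)² A = (b+1)³`.
    have hX : (0 : ℝ) < (b + 1) ^ 2 := by positivity
    refine mul_left_cancel₀ hX.ne' ?_
    linear_combination hself'
  refine ⟨hval, ?_⟩
  rw [hB', hval]
  field_simp
  ring

end Family

lemma F_bdry_of_lt {i : Fin (b + 2)} (hi : (i : ℕ) < b) (k : Fin 2) :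
    F i (.bdry k) = (.inner [] k : Vert b) := by
  simp [F, hi]

lemma F_bdry_end {i : Fin (b + 2)} {k n : Fin 2} (hkn : k ≠ n) (hi : (i : ℕ) = b + k) :
    F i (.bdry n) = (.inner [] k : Vert b) := by
  fin_cases k <;> fin_cases n <;> simp_all [F]

end BubbleDiamond

theorem mainTheorem6 (b : ℕ) (hb : 1 ≤ b) :
    -- the self-similar measure exists and is unique
    (∃! μ : MeasureTheory.Measure (BubbleDiamond.K b), BubbleDiamond.IsSelfSimilarMeasure μ) ∧
    ∀ μ : MeasureTheory.Measure (BubbleDiamond.K b), BubbleDiamond.IsSelfSimilarMeasure μ →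
      -- the multiharmonic functions exist and are unique
      (∀ (j : ℕ) (k : Fin 2), ∃! g : C(BubbleDiamond.K b, ℝ),
        BubbleDiamond.IsMultiharmonic μ j k g) ∧
      ∀ f : ℕ → Fin 2 → C(BubbleDiamond.K b, ℝ),
        (∀ j k, BubbleDiamond.IsMultiharmonic μ j k (f j k)) →
        ∃ a β p q : ℕ → ℝ,
          -- the four quantities, which do not depend on the indices `i`, `k`, `n`
          (∀ (ℓ : ℕ) (k n : Fin 2), k ≠ n →
            a ℓ = ∫ x, f ℓ k x * f 0 k x ∂μ ∧
            β ℓ = ∫ x, f ℓ k x * f 0 n x ∂μ ∧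
            ∀ i : Fin (b + 2),
              -- `F_i q_k`, `F_i q_n` for the `b` parallel copies
              ((i : ℕ) < b →
                p ℓ = ((BubbleDiamond.renorm b / (b + 2)) ^ ℓ)⁻¹ *
                  f ℓ k (BubbleDiamond.FK i (BubbleDiamond.q k)) ∧
                q ℓ = ((BubbleDiamond.renorm b / (b + 2)) ^ ℓ)⁻¹ *
                  f ℓ k (BubbleDiamond.FK i (BubbleDiamond.q n))) ∧
              -- the same two points as `F_i q_n` for the copy at `q_k`
              -- and as `F_i q_k` for the copy at `q_n`
              ((i : ℕ) = b + k →
                p ℓ = ((BubbleDiamond.renorm b / (b + 2)) ^ ℓ)⁻¹ *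
                  f ℓ k (BubbleDiamond.FK i (BubbleDiamond.q n))) ∧
              ((i : ℕ) = b + n →
                q ℓ = ((BubbleDiamond.renorm b / (b + 2)) ^ ℓ)⁻¹ *
                  f ℓ k (BubbleDiamond.FK i (BubbleDiamond.q k)))) ∧
          -- the initial values
          a 0 = (b + 1) / (2 + 4 * b) ∧ β 0 = b / (2 + 4 * b) ∧
          p 0 = (b + 1) / (2 * b + 1) ∧ q 0 = b / (2 * b + 1) ∧
          -- the recursion
          ∀ j : ℕ, 0 < j →
            (2 * b + 1) * p j =
              -(∑ ℓ ∈ Finset.range j,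
                  (p (j - ℓ - 1) * ((b + 1) ^ 2 * a ℓ + b ^ 2 * β ℓ)
                    + b * (b + 1) * q (j - ℓ - 1) * (a ℓ + β ℓ)))
                - (b + 1) * β (j - 1) ∧
            (2 * b + 1) * q j =
              -(∑ ℓ ∈ Finset.range j,
                  (b * (b + 1) * p (j - ℓ - 1) * (a ℓ + β ℓ)
                    + q (j - ℓ - 1) * ((b + 1) ^ 2 * a ℓ + b ^ 2 * β ℓ)))
                - b * β (j - 1) := by
  open BubbleDiamond in
  refine ⟨?_, fun μ hμ => ?_⟩
  · obtain ⟨μ, hμ⟩ := exists_isSelfSimilarMeasure hb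
    exact ⟨μ, hμ, fun ν hν => hν.unique hb hμ⟩
  have := hμ.isProbabilityMeasure
  refine ⟨existsUnique_isMultiharmonic hb, fun f hf => ?_⟩
  set c : ℝ := renorm b / (b + 2) with hc
  have hc0 : 0 < c := by have := renorm_pos hb; positivity
  let a : ℕ → ℝ := fun l => ∫ x, f l 0 x * f 0 0 x ∂μ
  let β : ℕ → ℝ := fun l => ∫ x, f l 0 x * f 0 1 x ∂μ
  let p : ℕ → ℝ := fun l => (c ^ l)⁻¹ * res (f l 0) (.inner [] 0)
  let q' : ℕ → ℝ := fun l => (c ^ l)⁻¹ * res (f l 0) (.inner [] 1)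
  have hp : ∀ l, c ^ l * p l = res (f l 0) (.inner [] 0) := fun l =>
    mul_inv_cancel_left₀ (by positivity) _
  have hq : ∀ l, c ^ l * q' l = res (f l 0) (.inner [] 1) := fun l =>
    mul_inv_cancel_left₀ (by positivity) _
  obtain ⟨hp0, hq0⟩ := res_zero_inner hb hμ hf
  obtain ⟨ha0, hβ0⟩ := integral_zero_zero hb hμ hf
  refine ⟨a, β, p, q', fun l k n hkn => ?_, ha0, hβ0, by simpa [p] using hp0,
    by simpa [q'] using hq0, fun j hj => ?_⟩
  -- The sequences are defined with the first boundary point; the reflection transfers them to the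
  -- other one.
  · have hkk : res (f l k) (.inner [] k) = res (f l 0) (.inner [] 0) := by
      fin_cases k
      · rfl
      · exact res_inner_reflect hb hμ hf l 0 0
    have hkn' : res (f l k) (.inner [] n) = res (f l 0) (.inner [] 1) := by
      fin_cases k <;> fin_cases n
      · exact absurd rfl hkn
      · rfl
      · exact res_inner_reflect hb hμ hf l 0 1
      · exact absurd rfl hkn
    refine ⟨?_, ?_, fun i => ⟨fun hi => ⟨?_, ?_⟩, fun hi => ?_, fun hi => ?_⟩⟩
    · fin_cases k
      · rfl
      · exact (integral_comp_reflectK_mul hb hμ hf l 0 0).symm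
    · fin_cases k <;> fin_cases n
      · exact absurd rfl hkn
      · rfl
      · exact (integral_comp_reflectK_mul hb hμ hf l 0 1).symm
      · exact absurd rfl hkn
    · rw [FK_q hb, F_bdry_of_lt hi]
      exact congrArg _ hkk.symm
    · rw [FK_q hb, F_bdry_of_lt hi]
      exact congrArg _ hkn'.symm
    · rw [FK_q hb, F_bdry_end hkn hi]
      exact congrArg _ hkk.symm
    · rw [FK_q hb, F_bdry_end hkn.symm hi]
      exact congrArg _ hkn'.symm
  · obtain ⟨j, rfl⟩ := Nat.exists_eq_succ_of_ne_zero hj.ne'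
    obtain ⟨h1, h2⟩ := recursion hb hμ hf (fun _ => rfl) (fun _ => rfl) hp hq j
    have hidx : ∀ l, j.succ - l - 1 = j - l := fun l => by omega
    simp only [hidx, Nat.succ_eq_add_one, Nat.add_sub_cancel]
    have e1 : ∀ x y : ℕ → ℝ, ∑ l ∈ Finset.range (j + 1),
        (x (j - l) * ((b + 1) ^ 2 * a l + b ^ 2 * β l) + b * (b + 1) * y (j - l) * (a l + β l))
        = (b + 1) ^ 2 * ∑ l ∈ Finset.range (j + 1), x (j - l) * a l
          + b ^ 2 * ∑ l ∈ Finset.range (j + 1), x (j - l) * β l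
          + b * (b + 1) * (∑ l ∈ Finset.range (j + 1), y (j - l) * a l
          + ∑ l ∈ Finset.range (j + 1), y (j - l) * β l) := fun x y => by
      simp only [Finset.mul_sum, ← Finset.sum_add_distrib]
      exact Finset.sum_congr rfl fun l _ => by ring
    constructor
    · rw [e1]
      -- Inverts the system, using `(b + 1)² - b² = 2b + 1`.
      linear_combination (b + 1) * h1 + b * h2
    -- Swapping the summands puts the sum in the shape of `e1` with `p` and `q` interchanged.
    · rw [Finset.sum_congr rfl fun l _ => add_comm _ _, e1]
      linear_combination b * h1 + (b + 1) * h2
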